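/- Let $L>0$, let $a,b,c>0$, and let $p\in L^1[0,L]$. Consider the Melan problem $$w''''(x)-\Big(a+b\int_0^L w\Big)w''(x)+c\int_0^L w=p(x)\ \text{ for a.e. } x\in(0,L),\qquad w(0)=w(L)=w''(0)=w''(L)=0,\tag{P}$$ whose solutions are sought in $W^{4,1}[0,L]$. A function $\alpha\in W^{4,1}[0,L]$ satisfying the boundary conditions of (P) is a lower solution if $$\alpha''''-\Big(a+b\int_0^L\alpha\Big)\alpha''+c\int_0^L\alpha\le p\quad\text{a.e. on }(0,L);$$ an upper solution $\beta$ is defined with the reverse inequality. For $t>0$ put $$\sigma(t)=\frac{3t^3}{6t\cosh t+6t-12\sinh t-t^3}.$$ **Theorem 4.1.** Let $M,N>0$ with $N\le \frac{4M}{L^3}\,\sigma(\sqrt M\,L)$. Suppose that (P) has a lower solution $\alpha$ and an upper solution $\beta$ such that $$0\le\alpha\le\beta,\qquad 0\ge\alpha''\ge\beta''\qquad\text{on }[0,L],$$ $$a+b\int_0^L\beta\le M,\qquad c-b\min_{[0,L]}\beta''\le N.$$ Then (P) has at least one solution in the sector $$[\alpha,\beta]=\{u\in C^2[0,L]:\ \alpha\le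 u\le\beta,\ \alpha''\ge u''\ge\beta''\text{ on }[0,L]\}.$$ Moreover, consider the iteration which, given $y_{n-1}$, determines $y_n\in W^{4,1}[0,L]$ as the solution of the linear problem $$y_n''''-My_n''+N\int_0^L y_n=p+ay_{n-1}''+b\,y_{n-1}''\int_0^L y_{n-1}-c\int_0^L y_{n-1}-My_{n-1}''+N\int_0^L y_{n-1}\quad\text{a.e. on }(0,L),$$ $$y_n(0)=y_n(L)=y_n''(0)=y_n''(L)=0,\qquad n=1,2,\dots$$ Started at $y_0=\alpha$ and at $y_0=\beta$, it determines unique sequences $(\alpha_n)$ and $(\beta_n)$ on $[0,L]$, with $\alpha_0=\alpha$ and $\beta_0=\beta$. On $[0,L]$ and for all $n\ge0$ they satisfy $$\alpha_n\le\alpha_{n+1},\quad \alpha_n\le\beta_n,\quad \beta_{n+1}\le\beta_n,\qquad \alpha_n''\ge\alpha_{n+1}'',\quad \alpha_n''\ge\beta_n'',\quad \beta_{n+1}''\ge\beta_n''.$$ They converge uniformly on $[0,L]$ to solutions $\underline y$ and $\overline y$ of (P) in $[\alpha,\beta]$, respectively. These are the minimal and the maximal solution of (P) in $[\alpha,\beta]$: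 every solution $y\in[\alpha,\beta]$ of (P) satisfies $\underline y\le y\le\overline y$ and $\underline y''\ge y''\ge\overline y''$ on $[0,L]$. -/

import Mathlib

open Set Filter Topology MeasureTheory

noncomputable section

namespace Melan

/-- The `k`-th derivative of `u` on the closed interval `[0, L]` (one-sided at the endpoints). -/
def D (L : ℝ) (k : ℕ) (u : ℝ → ℝ) : ℝ → ℝ :=
  iteratedDerivWithin k u (Icc 0 L)

/-- The Sobolev space `W^{4,1}[0, L]`, through continuous representatives: `u` is `C³` on
`[0, L]` and `u'''` is absolutely continuous there. The fourth derivative `D L 4 u` then exists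
almost everywhere on `[0, L]`, is integrable, and is the weak fourth derivative of `u`. -/
def MemW41 (L : ℝ) (u : ℝ → ℝ) : Prop :=
  ContDiffOn ℝ 3 u (Icc 0 L) ∧ AbsolutelyContinuousOnInterval (D L 3 u) 0 L

/-- Hinged (Navier) boundary conditions `u(0) = u(L) = u''(0) = u''(L) = 0`. -/
def Hinged (L : ℝ) (u : ℝ → ℝ) : Prop :=
  u 0 = 0 ∧ u L = 0 ∧ D L 2 u 0 = 0 ∧ D L 2 u L = 0

/-- Left-hand side `u'''' - (a + b ∫ u) u'' + c ∫ u` of the Melan equation. -/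
def melanLHS (L a b c : ℝ) (u : ℝ → ℝ) (x : ℝ) : ℝ :=
  D L 4 u x - (a + b * ∫ t in (0 : ℝ)..L, u t) * D L 2 u x + c * ∫ t in (0 : ℝ)..L, u t

/-- Solution in `W^{4,1}[0, L]` of the Melan problem with hinged ends. -/
def IsSolution (L a b c : ℝ) (p u : ℝ → ℝ) : Prop :=
  MemW41 L u ∧ Hinged L u ∧ ∀ᵐ x, x ∈ Ioo 0 L → melanLHS L a b c u x = p x

/-- Lower solution of the Melan problem with hinged ends. -/
def IsLowerSolution (L a b c : ℝ) (p u : ℝ → ℝ) : Prop :=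
  MemW41 L u ∧ Hinged L u ∧ ∀ᵐ x, x ∈ Ioo 0 L → melanLHS L a b c u x ≤ p x

/-- Upper solution of the Melan problem with hinged ends. -/
def IsUpperSolution (L a b c : ℝ) (p u : ℝ → ℝ) : Prop :=
  MemW41 L u ∧ Hinged L u ∧ ∀ᵐ x, x ∈ Ioo 0 L → p x ≤ melanLHS L a b c u x

/-- `u ≤ v` and `u'' ≥ v''` on `[0, L]`. -/
def Precedes (L : ℝ) (u v : ℝ → ℝ) : Prop :=
  ∀ x ∈ Icc 0 L, u x ≤ v x ∧ D L 2 v x ≤ D L 2 u x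

/-- The sector `[α, β]`: the `u` in `C²[0, L]` with `α ≤ u ≤ β` and `α'' ≥ u'' ≥ β''`. -/
def sector (L : ℝ) (α β : ℝ → ℝ) : Set (ℝ → ℝ) :=
  {u | ContDiffOn ℝ 2 u (Icc 0 L) ∧ Precedes L α u ∧ Precedes L u β}

/-- `σ(t) = 3 t³ / (6 t cosh t + 6 t - 12 sinh t - t³)`. -/
def σ (t : ℝ) : ℝ :=
  3 * t ^ 3 / (6 * t * Real.cosh t + 6 * t - 12 * Real.sinh t - t ^ 3)

/-- The linear integro-differential operator `G w = w'''' - M w'' + N ∫ w`. -/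
def G (L M N : ℝ) (w : ℝ → ℝ) (x : ℝ) : ℝ :=
  D L 4 w x - M * D L 2 w x + N * ∫ t in (0 : ℝ)..L, w t

/-- The nonlinearity `f(x, I, z) = p(x) + a z + b z I - c I`. -/
def f (a b c : ℝ) (p : ℝ → ℝ) (x I z : ℝ) : ℝ :=
  p x + a * z + b * z * I - c * I

/-- One step of the iteration: `v` in `W^{4,1}[0, L]`, with hinged ends, solves the linear problem
`G v = f(x, ∫ u, u'') - M u'' + N ∫ u`. -/
def IsStep (L a b c M N : ℝ) (p u v : ℝ → ℝ) : Prop :=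
  MemW41 L v ∧ Hinged L v ∧ ∀ᵐ x, x ∈ Ioo 0 L →
    G L M N v x = f a b c p x (∫ t in (0 : ℝ)..L, u t) (D L 2 u x) - M * D L 2 u x
      + N * ∫ t in (0 : ℝ)..L, u t

/-- `y` is an iteration sequence started at `y₀`. -/
def IsIteration (L a b c M N : ℝ) (p y₀ : ℝ → ℝ) (y : ℕ → ℝ → ℝ) : Prop :=
  y 0 = y₀ ∧ ∀ n, IsStep L a b c M N p (y n) (y (n + 1))

end Melan

end

/-!
Write `M = m²`. With hinged ends, `-w''(x)` is the integral of `w'''' - m² w''` against the positive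
Green kernel of `-z'' + m² z` at `x`, and the integral of `w` is that of `w'''' - m² w''` against
the unit-load deflection `ψ`, for which `-ψ''` is the torsion function `e`. Adding a multiple of `ψ`
to `w` removes the nonlocal term of `G`. The product `e(x) ψ(s)` is at most a constant times the
Green kernel at `(x, s)`, and the bound on `N` through `σ` is exactly what makes this constant small
enough: `G w ≥ 0` then forces `w'' ≤ 0`, hence also `w ≥ 0`.

In the order `u ≤ v`, `u'' ≥ v''` the operator `G` is therefore inverse monotone, while the bounds
on `a + b ∫ β` and on `c - b β''` make the right-hand side of the iteration monotone below `β`. The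
iterates from `α` and `β` are thus monotone and trapped between `α` and `β`, so their integrals and
second derivatives converge pointwise. By bounded convergence `yₙ'''' - M yₙ''` converges in `L¹`,
which the Green kernel turns into uniform convergence of `yₙ` and `yₙ''`.
-/

namespace Melan

section Calculus

variable {s : Set ℝ} {w w' w'' g : ℝ → ℝ} {a b : ℝ}

theorem ae_restrict_uIoc {P : ℝ → Prop} (hab : a ≤ b) (h : ∀ᵐ x, x ∈ Ioo a b → P x) :
    ∀ᵐ x ∂volume.restrict (uIoc a b), P x := by
  rwa [uIoc_of_le hab, ← restrict_Ioo_eq_restrict_Ioc, ae_restrict_iff' measurableSet_Ioo]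

theorem ae_restrict_Icc {P : ℝ → Prop} (h : ∀ᵐ x, x ∈ Ioo a b → P x) :
    ∀ᵐ x ∂volume.restrict (Icc a b), P x := by
  rwa [← restrict_Ioo_eq_restrict_Icc, ae_restrict_iff' measurableSet_Ioo]

theorem contDiffOn_succ_of_hasDerivWithinAt {n : ℕ} (hs : UniqueDiffOn ℝ s)
    (h : ∀ x ∈ s, HasDerivWithinAt w (w' x) s x) (hw' : ContDiffOn ℝ n w' s) :
    ContDiffOn ℝ (n + 1) w s :=
  (contDiffOn_succ_iff_derivWithin hs).2 ⟨fun x hx => (h x hx).differentiableWithinAt, by simp,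
    hw'.congr fun x hx => (h x hx).derivWithin (hs x hx)⟩

theorem absolutelyContinuousOnInterval_congr (hw : AbsolutelyContinuousOnInterval w a b)
    (h : EqOn w g (uIcc a b)) : AbsolutelyContinuousOnInterval g a b := by
  refine Tendsto.congr' ?_ hw
  filter_upwards [mem_inf_of_right (mem_principal_self _)] with E hE
  exact Finset.sum_congr rfl fun i hi => by rw [h (hE.1 i hi).1, h (hE.1 i hi).2]

theorem absolutelyContinuousOnInterval_of_hasDerivWithinAt (hab : a < b)
    (h : ∀ x ∈ Icc a b, HasDerivWithinAt w (w' x) (Icc a b) x) (hw' : ContinuousOn w' (Icc a b)) :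
    AbsolutelyContinuousOnInterval w a b := by
  apply ContDiffOn.absolutelyContinuousOnInterval
  rw [uIcc_of_le hab.le]
  exact contDiffOn_succ_of_hasDerivWithinAt (n := 0) (uniqueDiffOn_Icc hab) h
    (contDiffOn_zero.2 hw')

theorem ae_deriv_eq (hab : a ≤ b) (h : ∀ᵐ x, x ∈ Ioo a b → HasDerivAt w (w' x) x) :
    deriv w =ᵐ[volume.restrict (uIoc a b)] w' :=
  (ae_restrict_uIoc hab h).mono fun _ hx => hx.deriv

theorem intervalIntegrable_of_ae_hasDerivAt (hab : a ≤ b)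
    (hw : AbsolutelyContinuousOnInterval w a b)
    (h : ∀ᵐ x, x ∈ Ioo a b → HasDerivAt w (w' x) x) : IntervalIntegrable w' volume a b :=
  hw.intervalIntegrable_deriv.congr_ae (ae_deriv_eq hab h)

theorem integral_eq_sub_of_ae_hasDerivAt (hab : a ≤ b)
    (hw : AbsolutelyContinuousOnInterval w a b)
    (h : ∀ᵐ x, x ∈ Ioo a b → HasDerivAt w (w' x) x) : ∫ x in a..b, w' x = w b - w a := by
  rw [← hw.integral_deriv_eq_sub]
  exact (intervalIntegral.integral_congr_ae_restrict (ae_deriv_eq hab h)).symm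

theorem nonneg_of_hasDerivAt2_nonpos (hw : ContinuousOn w (Icc a b))
    (hw' : ∀ x ∈ Ioo a b, HasDerivAt w (w' x) x) (hw'' : ∀ x ∈ Ioo a b, HasDerivAt w' (w'' x) x)
    (hneg : ∀ x ∈ Ioo a b, w'' x ≤ 0) (ha : 0 ≤ w a) (hb : 0 ≤ w b) {x : ℝ} (hx : x ∈ Icc a b) :
    0 ≤ w x := by
  have hconc : ConcaveOn ℝ (Icc a b) w := by
    apply concaveOn_of_hasDerivWithinAt2_nonpos (convex_Icc a b) hw (f' := w') (f'' := w'') <;>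
      rw [interior_Icc]
    exacts [fun x hx => (hw' x hx).hasDerivWithinAt, fun x hx => (hw'' x hx).hasDerivWithinAt, hneg]
  have hab : a ≤ b := hx.1.trans hx.2
  exact (le_min ha hb).trans
    (hconc.min_le_of_mem_Icc (left_mem_Icc.2 hab) (right_mem_Icc.2 hab) hx)

end Calculus

section Sobolev

variable {L : ℝ} {u v w : ℝ → ℝ} {x : ℝ} {k : ℕ}

@[simp] theorem D_zero (L : ℝ) (u : ℝ → ℝ) : D L 0 u = u := iteratedDerivWithin_zero

theorem D_succ (L : ℝ) (k : ℕ) (u : ℝ → ℝ) : D L (k + 1) u = derivWithin (D L k u) (Icc 0 L) :=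
  iteratedDerivWithin_succ

theorem D_add_smul (hL : 0 < L) (hu : ContDiffOn ℝ k u (Icc 0 L))
    (hv : ContDiffOn ℝ k v (Icc 0 L)) (c : ℝ) :
    EqOn (D L k (u + c • v)) (D L k u + c • D L k v) (Icc 0 L) := by
  intro x hx
  have hs := uniqueDiffOn_Icc hL
  simp only [D, Pi.add_apply, Pi.smul_apply]
  rw [iteratedDerivWithin_add (g := c • v) hx hs (hu x hx) ((hv x hx).const_smul c),
    iteratedDerivWithin_const_smul hx hs c (hv x hx)]

theorem D_succ_eqOn (hL : 0 < L) {w' : ℝ → ℝ} (hk : EqOn (D L k u) w (Icc 0 L))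
    (h : ∀ x ∈ Icc 0 L, HasDerivWithinAt w (w' x) (Icc 0 L) x) :
    EqOn (D L (k + 1) u) w' (Icc 0 L) := by
  intro x hx
  rw [D_succ, derivWithin_congr hk (hk hx)]
  exact (h x hx).derivWithin (uniqueDiffOn_Icc hL x hx)

theorem D_succ_eq_of_hasDerivAt {d : ℝ} (hk : EqOn (D L k u) w (Icc 0 L)) (hx : x ∈ Ioo 0 L)
    (h : HasDerivAt w d x) : D L (k + 1) u x = d := by
  have hx' : Icc 0 L ∈ 𝓝 x := Icc_mem_nhds hx.1 hx.2
  rw [D_succ, derivWithin_of_mem_nhds hx', (hk.eventuallyEq_of_mem hx').deriv_eq, h.deriv]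

namespace MemW41

theorem hasDerivWithinAt (hL : 0 < L) (hu : MemW41 L u) (hk : k < 3) (hx : x ∈ Icc 0 L) :
    HasDerivWithinAt (D L k u) (D L (k + 1) u x) (Icc 0 L) x := by
  rw [D_succ]
  exact (hu.1.differentiableOn_iteratedDerivWithin (m := k) (mod_cast hk)
    (uniqueDiffOn_Icc hL) x hx).hasDerivWithinAt

theorem hasDerivAt (hL : 0 < L) (hu : MemW41 L u) (hk : k < 3) (hx : x ∈ Ioo 0 L) :
    HasDerivAt (D L k u) (D L (k + 1) u x) x :=
  (hu.hasDerivWithinAt hL hk (Ioo_subset_Icc_self hx)).hasDerivAt (Icc_mem_nhds hx.1 hx.2)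

theorem continuousOn (hL : 0 < L) (hu : MemW41 L u) (hk : k ≤ 3) :
    ContinuousOn (D L k u) (Icc 0 L) :=
  hu.1.continuousOn_iteratedDerivWithin (mod_cast hk) (uniqueDiffOn_Icc hL)

theorem absolutelyContinuousOnInterval (hL : 0 < L) (hu : MemW41 L u) (hk : k ≤ 3) :
    AbsolutelyContinuousOnInterval (D L k u) 0 L := by
  rcases hk.lt_or_eq with hk | rfl
  · exact absolutelyContinuousOnInterval_of_hasDerivWithinAt hL
      (fun x hx => hu.hasDerivWithinAt hL hk hx) (hu.continuousOn hL hk)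
  · exact hu.2

theorem ae_hasDerivAt (hL : 0 < L) (hu : MemW41 L u) (hk : k ≤ 3) :
    ∀ᵐ x, x ∈ Ioo 0 L → HasDerivAt (D L k u) (D L (k + 1) u x) x := by
  filter_upwards [(hu.absolutelyContinuousOnInterval hL hk).ae_differentiableAt] with x h hx
  rw [uIcc_of_le hL.le] at h
  rw [D_succ, derivWithin_of_mem_nhds (Icc_mem_nhds hx.1 hx.2)]
  exact (h (Ioo_subset_Icc_self hx)).hasDerivAt

theorem intervalIntegrable (hL : 0 < L) (hu : MemW41 L u) (hk : k ≤ 4) :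
    IntervalIntegrable (D L k u) volume 0 L := by
  cases k with
  | zero =>
    exact ContinuousOn.intervalIntegrable_of_Icc hL.le (hu.continuousOn hL (by lia))
  | succ k =>
    exact intervalIntegrable_of_ae_hasDerivAt hL.le
      (hu.absolutelyContinuousOnInterval hL (by lia)) (hu.ae_hasDerivAt hL (by lia))

theorem add_smul (hL : 0 < L) (hu : MemW41 L u) (hv : MemW41 L v) (c : ℝ) :
    MemW41 L (u + c • v) := by
  refine ⟨hu.1.add (hv.1.const_smul c),
    absolutelyContinuousOnInterval_congr (hu.2.add (hv.2.const_smul c)) ?_⟩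
  rw [uIcc_of_le hL.le]
  exact (D_add_smul hL hu.1 hv.1 c).symm

theorem D_two_add_smul (hL : 0 < L) (hu : MemW41 L u) (hv : MemW41 L v) (c : ℝ)
    (hx : x ∈ Icc 0 L) : D L 2 (u + c • v) x = D L 2 u x + c * D L 2 v x :=
  D_add_smul hL (hu.1.of_le (by norm_num)) (hv.1.of_le (by norm_num)) c hx

theorem integral_add_smul (hL : 0 < L) (hu : MemW41 L u) (hv : MemW41 L v) (c : ℝ) :
    ∫ x in (0 : ℝ)..L, (u + c • v) x =
      (∫ x in (0 : ℝ)..L, u x) + c * ∫ x in (0 : ℝ)..L, v x := by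
  have hint : ∀ {w}, MemW41 L w → IntervalIntegrable w volume 0 L := fun hw => by
    simpa using hw.intervalIntegrable hL (k := 0) (by norm_num)
  simp only [Pi.add_apply, Pi.smul_apply, smul_eq_mul]
  rw [intervalIntegral.integral_add (hint hu) ((hint hv).const_mul c),
    intervalIntegral.integral_const_mul]

end MemW41

theorem memW41_of_hasDerivWithinAt (hL : 0 < L) {w₀ w₁ w₂ w₃ : ℝ → ℝ}
    (h₀ : ∀ x ∈ Icc 0 L, HasDerivWithinAt w₀ (w₁ x) (Icc 0 L) x)
    (h₁ : ∀ x ∈ Icc 0 L, HasDerivWithinAt w₁ (w₂ x) (Icc 0 L) x)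
    (h₂ : ∀ x ∈ Icc 0 L, HasDerivWithinAt w₂ (w₃ x) (Icc 0 L) x)
    (h₃ : AbsolutelyContinuousOnInterval w₃ 0 L) :
    MemW41 L w₀ ∧ EqOn (D L 2 w₀) w₂ (Icc 0 L) ∧ EqOn (D L 3 w₀) w₃ (Icc 0 L) := by
  have e₁ : EqOn (D L 1 w₀) w₁ (Icc 0 L) := D_succ_eqOn hL (by simp [EqOn]) h₀
  have e₂ : EqOn (D L 2 w₀) w₂ (Icc 0 L) := D_succ_eqOn hL e₁ h₁
  have e₃ : EqOn (D L 3 w₀) w₃ (Icc 0 L) := D_succ_eqOn hL e₂ h₂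
  have hI : uIcc 0 L = Icc 0 L := uIcc_of_le hL.le
  have hs := uniqueDiffOn_Icc hL
  have c₃ : ContDiffOn ℝ (0 : ℕ) w₃ (Icc 0 L) := contDiffOn_zero.2 (hI ▸ h₃.continuousOn)
  have c₀ : ContDiffOn ℝ ((2 : ℕ) + 1) w₀ (Icc 0 L) :=
    contDiffOn_succ_of_hasDerivWithinAt hs h₀ <|
      contDiffOn_succ_of_hasDerivWithinAt (n := 1) hs h₁ <|
        contDiffOn_succ_of_hasDerivWithinAt (n := 0) hs h₂ c₃
  refine ⟨⟨c₀.of_le (by norm_num), absolutelyContinuousOnInterval_congr h₃ ?_⟩, e₂, e₃⟩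
  rw [hI]
  exact e₃.symm

/-- The functions of `W^{4,1}[0, L]` with hinged ends, the domain of the linear operators below. -/
def hingedW41 (L : ℝ) : Set (ℝ → ℝ) :=
  {w | MemW41 L w ∧ Hinged L w}

theorem add_smul_mem_hingedW41 (hL : 0 < L) (hu : u ∈ hingedW41 L) (hv : v ∈ hingedW41 L)
    (c : ℝ) : u + c • v ∈ hingedW41 L := by
  obtain ⟨hu, hu₀, huL, hu₀', huL'⟩ := hu
  obtain ⟨hv, hv₀, hvL, hv₀', hvL'⟩ := hv
  refine ⟨hu.add_smul hL hv c, by simp [hu₀, hv₀], by simp [huL, hvL], ?_, ?_⟩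
  · rw [hu.D_two_add_smul hL hv c (left_mem_Icc.2 hL.le), hu₀', hv₀']; ring
  · rw [hu.D_two_add_smul hL hv c (right_mem_Icc.2 hL.le), huL', hvL']; ring

/-- The operator `w'''' - M w''` of a beam under the constant tension `M`; the operator `G` adds
the nonlocal term `N ∫ w` to it. -/
noncomputable def beamOp (L M : ℝ) (w : ℝ → ℝ) (x : ℝ) : ℝ :=
  D L 4 w x - M * D L 2 w x

theorem MemW41.intervalIntegrable_beamOp (hL : 0 < L) (hw : MemW41 L w) (M : ℝ) :
    IntervalIntegrable (beamOp L M w) volume 0 L :=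
  (hw.intervalIntegrable hL (by norm_num)).sub
    ((hw.intervalIntegrable hL (by norm_num)).const_mul M)

theorem MemW41.beamOp_add_smul (hL : 0 < L) (hu : MemW41 L u) (hv : MemW41 L v) (M c : ℝ) :
    ∀ᵐ x, x ∈ Ioo 0 L → beamOp L M (u + c • v) x = beamOp L M u x + c * beamOp L M v x := by
  filter_upwards [hu.ae_hasDerivAt hL (k := 3) le_rfl, hv.ae_hasDerivAt hL (k := 3) le_rfl]
    with x hux hvx hx
  have h₄ : D L 4 (u + c • v) x = D L 4 u x + c * D L 4 v x :=
    D_succ_eq_of_hasDerivAt (D_add_smul hL hu.1 hv.1 c) hx ((hux hx).add ((hvx hx).const_smul c))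
  rw [beamOp, h₄, hu.D_two_add_smul hL hv c (Ioo_subset_Icc_self hx)]
  simp only [beamOp]
  ring

theorem MemW41.G_add_smul (hL : 0 < L) (hu : MemW41 L u) (hv : MemW41 L v) (M N c : ℝ) :
    ∀ᵐ x, x ∈ Ioo 0 L → G L M N (u + c • v) x = G L M N u x + c * G L M N v x := by
  filter_upwards [hu.beamOp_add_smul hL hv M c] with x h hx
  change beamOp L M (u + c • v) x + N * _ = beamOp L M u x + N * _ + c * (beamOp L M v x + N * _)
  rw [h hx, hu.integral_add_smul hL hv]
  ring

end Sobolev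

section Hyperbolic

variable {t m : ℝ}

theorem sinh_le_mul_cosh (ht : 0 ≤ t) : Real.sinh t ≤ t * Real.cosh t := by
  have h := (convex_Icc 0 t).image_sub_le_mul_sub_of_deriv_le Real.continuous_sinh.continuousOn
    Real.differentiable_sinh.differentiableOn (C := Real.cosh t) ?_ 0 (left_mem_Icc.2 ht) t
    (right_mem_Icc.2 ht) ht
  · simpa [mul_comm] using h
  · intro s hs
    rw [interior_Icc] at hs
    rw [Real.deriv_sinh, Real.cosh_le_cosh, abs_of_pos hs.1, abs_of_nonneg ht]
    exact hs.2.le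

theorem two_mul_cosh_sub_one_le (ht : 0 ≤ t) : 2 * (Real.cosh t - 1) ≤ t * Real.sinh t := by
  calc 2 * (Real.cosh t - 1) = 4 * (Real.sinh (t / 2) * Real.sinh (t / 2)) := by
        rw [show t = 2 * (t / 2) by ring, Real.cosh_two_mul, Real.cosh_sq]; ring_nf
    _ ≤ 4 * (Real.sinh (t / 2) * (t / 2 * Real.cosh (t / 2))) := by
        gcongr
        exact sinh_le_mul_cosh (by positivity)
    _ = t * Real.sinh t := by
        conv_rhs => rw [show t = 2 * (t / 2) by ring, Real.sinh_two_mul]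
        ring

theorem hasDerivAt_sinh_mul_sub (m y x : ℝ) :
    HasDerivAt (fun x => Real.sinh (m * (x - y))) (m * Real.cosh (m * (x - y))) x := by
  simpa [mul_comm] using (((hasDerivAt_id x).sub_const y).const_mul m).sinh

theorem hasDerivAt_cosh_mul_sub (m y x : ℝ) :
    HasDerivAt (fun x => Real.cosh (m * (x - y))) (m * Real.sinh (m * (x - y))) x := by
  simpa [mul_comm] using (((hasDerivAt_id x).sub_const y).const_mul m).cosh

end Hyperbolic

section ExplicitSolutions

variable {L m x : ℝ}

/-- The torsion function: the solution of `-e'' + m² e = 1`, `e(0) = e(L) = 0`. -/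
noncomputable def torsion (L m x : ℝ) : ℝ :=
  (1 - Real.cosh (m * (x - L / 2)) / Real.cosh (m * L / 2)) / m ^ 2

/-- The derivative of `torsion L m`. -/
noncomputable def torsionDeriv (L m x : ℝ) : ℝ :=
  -(Real.sinh (m * (x - L / 2)) / Real.cosh (m * L / 2)) / m

/-- The torsional rigidity `E = ∫₀ᴸ e`, the integral of the torsion function. -/
noncomputable def torsionalRigidity (L m : ℝ) : ℝ :=
  ∫ x in (0 : ℝ)..L, torsion L m x

/-- The deflection of the hinged beam under a unit load: the solution of `ψ'''' - m² ψ'' = 1`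
with hinged ends. -/
noncomputable def unitLoad (L m x : ℝ) : ℝ :=
  (x * (L - x) / 2 - torsion L m x) / m ^ 2

/-- The derivative of `unitLoad L m`. -/
noncomputable def unitLoadDeriv (L m x : ℝ) : ℝ :=
  (L / 2 - x - torsionDeriv L m x) / m ^ 2

theorem hasDerivAt_torsion (hm : 0 < m) (x : ℝ) :
    HasDerivAt (torsion L m) (torsionDeriv L m x) x := by
  convert! ((((hasDerivAt_cosh_mul_sub m (L / 2) x).div_const
    (Real.cosh (m * L / 2))).const_sub 1).div_const (m ^ 2)) using 1
  rw [torsionDeriv]; field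

theorem hasDerivAt_torsionDeriv (hm : 0 < m) (x : ℝ) :
    HasDerivAt (torsionDeriv L m) (m ^ 2 * torsion L m x - 1) x := by
  convert! (((hasDerivAt_sinh_mul_sub m (L / 2) x).div_const
    (Real.cosh (m * L / 2))).neg.div_const m) using 1
  rw [torsion]; field

theorem hasDerivAt_unitLoad (hm : 0 < m) (x : ℝ) :
    HasDerivAt (unitLoad L m) (unitLoadDeriv L m x) x := by
  convert! ((((hasDerivAt_id x).mul ((hasDerivAt_id x).const_sub L)).div_const 2).sub
    (hasDerivAt_torsion hm x)).div_const (m ^ 2) using 1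
  simp only [unitLoadDeriv, id]; ring

theorem hasDerivAt_unitLoadDeriv (hm : 0 < m) (x : ℝ) :
    HasDerivAt (unitLoadDeriv L m) (-torsion L m x) x := by
  convert! (((hasDerivAt_id x).const_sub (L / 2)).sub
    (hasDerivAt_torsionDeriv hm x)).div_const (m ^ 2) using 1
  field

theorem continuous_torsion : Continuous (torsion L m) := by
  unfold torsion
  fun_prop

theorem continuous_unitLoad : Continuous (unitLoad L m) := by
  have := continuous_torsion (L := L) (m := m)
  unfold unitLoad
  fun_prop

theorem torsion_symm (L m x : ℝ) : torsion L m (L - x) = torsion L m x := by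
  rw [torsion, ← Real.cosh_neg, show -(m * (L - x - L / 2)) = m * (x - L / 2) by ring, torsion]

theorem torsion_zero (L m : ℝ) : torsion L m 0 = 0 := by
  rw [torsion, ← Real.cosh_neg, show -(m * (0 - L / 2)) = m * L / 2 by ring,
    div_self (Real.cosh_pos _).ne', sub_self, zero_div]

theorem torsion_right (L m : ℝ) : torsion L m L = 0 := by
  rw [← torsion_symm, sub_self, torsion_zero]

theorem unitLoad_symm (L m x : ℝ) : unitLoad L m (L - x) = unitLoad L m x := by
  rw [unitLoad, torsion_symm, unitLoad]; ring

theorem torsion_nonneg (m : ℝ) (hx : x ∈ Icc 0 L) : 0 ≤ torsion L m x := by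
  have h : Real.cosh (m * (x - L / 2)) ≤ Real.cosh (m * L / 2) := by
    rw [Real.cosh_le_cosh, mul_div_assoc, abs_mul, abs_mul]
    refine mul_le_mul_of_nonneg_left ?_ (abs_nonneg m)
    rw [abs_of_nonneg (a := L / 2) (by linarith [hx.1, hx.2]), abs_le]
    constructor <;> linarith [hx.1, hx.2]
  exact div_nonneg (sub_nonneg.2 ((div_le_one (Real.cosh_pos _)).2 h)) (sq_nonneg m)

theorem unitLoad_nonneg (hm : 0 < m) (hx : x ∈ Icc 0 L) : 0 ≤ unitLoad L m x :=
  nonneg_of_hasDerivAt2_nonpos continuous_unitLoad.continuousOn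
    (fun x _ => hasDerivAt_unitLoad hm x) (fun x _ => hasDerivAt_unitLoadDeriv hm x)
    (fun _ hx => neg_nonpos.2 (torsion_nonneg m (Ioo_subset_Icc_self hx)))
    (by simp [unitLoad, torsion_zero]) (by simp [unitLoad, torsion_right]) hx

theorem torsion_eq (hm : 0 < m) (x : ℝ) :
    torsion L m x =
      (1 - Real.cosh (m * x) + Real.tanh (m * L / 2) * Real.sinh (m * x)) / m ^ 2 := by
  have hc := (Real.cosh_pos (m * L / 2)).ne'
  rw [torsion, mul_sub, ← mul_div_assoc, Real.cosh_sub, Real.tanh_eq_sinh_div_cosh]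
  field

theorem torsion_le (hm : 0 < m) (x : ℝ) :
    torsion L m x ≤ Real.tanh (m * L / 2) * Real.sinh (m * x) / m ^ 2 := by
  rw [torsion_eq hm]
  gcongr
  linarith [Real.one_le_cosh (m * x)]

theorem torsionalRigidity_eq (hm : 0 < m) :
    torsionalRigidity L m = (L - 2 * Real.tanh (m * L / 2) / m) / m ^ 2 := by
  have hderiv (x : ℝ) :
      HasDerivAt (fun x => (torsionDeriv L m x + x) / m ^ 2) (torsion L m x) x := by
    convert! ((hasDerivAt_torsionDeriv hm x).add (hasDerivAt_id x)).div_const (m ^ 2) using 1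
    field
  rw [torsionalRigidity, intervalIntegral.integral_eq_sub_of_hasDerivAt (fun x _ => hderiv x)
    (continuous_torsion.intervalIntegrable _ _), torsionDeriv, torsionDeriv,
    show m * (L - L / 2) = m * L / 2 by ring, show m * (0 - L / 2) = -(m * L / 2) by ring,
    Real.sinh_neg, Real.tanh_eq_sinh_div_cosh]
  ring

theorem integral_unitLoad (L m : ℝ) :
    ∫ x in (0 : ℝ)..L, unitLoad L m x = (L ^ 3 / 12 - torsionalRigidity L m) / m ^ 2 := by
  have hpoly : ∫ x in (0 : ℝ)..L, x * (L - x) / 2 = L ^ 3 / 12 := by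
    simp only [mul_sub, ← pow_two]
    rw [intervalIntegral.integral_div, intervalIntegral.integral_sub
      (Continuous.intervalIntegrable (by fun_prop) _ _)
      (Continuous.intervalIntegrable (by fun_prop) _ _), intervalIntegral.integral_mul_const,
      integral_id, integral_pow]
    ring
  simp only [unitLoad]
  rw [intervalIntegral.integral_div, intervalIntegral.integral_sub
    (Continuous.intervalIntegrable (by fun_prop) _ _)
    (continuous_torsion.intervalIntegrable _ _), hpoly, torsionalRigidity]

theorem unitLoad_le (hm : 0 < m) (hx : x ∈ Icc 0 L) :
    unitLoad L m x ≤ torsionalRigidity L m / (2 * m) * Real.sinh (m * x) := by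
  have hmx : 0 ≤ m * x := mul_nonneg hm.le hx.1
  have hcosh := two_mul_cosh_sub_one_le hmx
  have hsinh : 0 ≤ m * (L - x) * (Real.sinh (m * x) - m * x) :=
    mul_nonneg (mul_nonneg hm.le (sub_nonneg.2 hx.2))
      (sub_nonneg.2 (Real.self_le_sinh_iff.2 hmx))
  have hgap : torsionalRigidity L m / (2 * m) * Real.sinh (m * x) - unitLoad L m x =
      (m * (L - x) * (Real.sinh (m * x) - m * x) +
        (m * x * Real.sinh (m * x) - 2 * (Real.cosh (m * x) - 1))) / (2 * m ^ 4) := by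
    rw [torsionalRigidity_eq hm, unitLoad, torsion_eq hm]
    field
  rw [← sub_nonneg, hgap]
  apply div_nonneg _ (by positivity)
  linarith

theorem memW41_unitLoad (hL : 0 < L) (hm : 0 < m) :
    MemW41 L (unitLoad L m) ∧ EqOn (D L 2 (unitLoad L m)) (-torsion L m) (Icc 0 L) ∧
      EqOn (D L 3 (unitLoad L m)) (-torsionDeriv L m) (Icc 0 L) :=
  memW41_of_hasDerivWithinAt hL (fun x _ => (hasDerivAt_unitLoad hm x).hasDerivWithinAt)
    (fun x _ => (hasDerivAt_unitLoadDeriv hm x).hasDerivWithinAt)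
    (fun x _ => (hasDerivAt_torsion hm x).neg.hasDerivWithinAt)
    (absolutelyContinuousOnInterval_of_hasDerivWithinAt hL
      (fun x _ => (hasDerivAt_torsionDeriv hm x).neg.hasDerivWithinAt)
      ((continuous_torsion.const_mul (m ^ 2)).sub continuous_const).neg.continuousOn)

theorem unitLoad_mem_hingedW41 (hL : 0 < L) (hm : 0 < m) : unitLoad L m ∈ hingedW41 L := by
  obtain ⟨hmem, h₂, -⟩ := memW41_unitLoad hL hm
  refine ⟨hmem, by simp [unitLoad, torsion_zero], by simp [unitLoad, torsion_right], ?_, ?_⟩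
  · simp [h₂ (left_mem_Icc.2 hL.le), torsion_zero]
  · simp [h₂ (right_mem_Icc.2 hL.le), torsion_right]

theorem beamOp_unitLoad (hL : 0 < L) (hm : 0 < m) (hx : x ∈ Ioo 0 L) :
    beamOp L (m ^ 2) (unitLoad L m) x = 1 := by
  obtain ⟨-, h₂, h₃⟩ := memW41_unitLoad hL hm
  rw [beamOp, D_succ_eq_of_hasDerivAt h₃ hx (hasDerivAt_torsionDeriv hm x).neg,
    h₂ (Ioo_subset_Icc_self hx), Pi.neg_apply]
  ring

end ExplicitSolutions

section GreenFunction

variable {L m x s : ℝ} {w : ℝ → ℝ}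

theorem MemW41.integral_green (hL : 0 < L) (hw : MemW41 L w) {k : ℕ} (hk : k ≤ 2)
    {κ κ' κ'' : ℝ → ℝ} (hκ : ∀ s, HasDerivAt κ (κ' s) s) (hκ' : ∀ s, HasDerivAt κ' (κ'' s) s)
    (hκ'' : Continuous κ'') {a b : ℝ} (ha : 0 ≤ a) (hab : a ≤ b) (hb : b ≤ L) :
    ∫ s in a..b, (κ s * D L (k + 2) w s - κ'' s * D L k w s) =
      (κ b * D L (k + 1) w b - κ' b * D L k w b) -
        (κ a * D L (k + 1) w a - κ' a * D L k w a) := by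
  have hκac : AbsolutelyContinuousOnInterval κ 0 L :=
    absolutelyContinuousOnInterval_of_hasDerivWithinAt hL (fun x _ => (hκ x).hasDerivWithinAt)
      fun x _ => (hκ' x).continuousAt.continuousWithinAt
  have hκ'ac : AbsolutelyContinuousOnInterval κ' 0 L :=
    absolutelyContinuousOnInterval_of_hasDerivWithinAt hL (fun x _ => (hκ' x).hasDerivWithinAt)
      hκ''.continuousOn
  have hac := (hκac.fun_mul (hw.absolutelyContinuousOnInterval hL (k := k + 1) (by lia))).fun_sub
    (hκ'ac.fun_mul (hw.absolutelyContinuousOnInterval hL (k := k) (by lia)))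
  have hsub : uIcc a b ⊆ uIcc 0 L := by
    rw [uIcc_of_le hab, uIcc_of_le (ha.trans (hab.trans hb))]
    exact Icc_subset_Icc ha hb
  apply integral_eq_sub_of_ae_hasDerivAt hab (hac.mono hsub)
  filter_upwards [hw.ae_hasDerivAt hL (k := k + 1) (by lia)] with s hs hmem
  have hs' : s ∈ Ioo 0 L := ⟨ha.trans_lt hmem.1, hmem.2.trans_le hb⟩
  convert! ((hκ s).mul (hs hs')).sub ((hκ' s).mul (hw.hasDerivAt hL (k := k) (by lia) hs')) using 1
  ring

theorem MemW41.integral_sinh_mul_beamOp (hL : 0 < L) (hw : MemW41 L w) (m y : ℝ) {a b : ℝ}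
    (ha : 0 ≤ a) (hab : a ≤ b) (hb : b ≤ L) :
    ∫ s in a..b, Real.sinh (m * (s - y)) * beamOp L (m ^ 2) w s =
      (Real.sinh (m * (b - y)) * D L 3 w b - m * Real.cosh (m * (b - y)) * D L 2 w b) -
        (Real.sinh (m * (a - y)) * D L 3 w a - m * Real.cosh (m * (a - y)) * D L 2 w a) := by
  rw [← hw.integral_green hL le_rfl (hasDerivAt_sinh_mul_sub m y)
    (fun s => (hasDerivAt_cosh_mul_sub m y s).const_mul m) (by fun_prop) ha hab hb]
  congr 1 with s
  rw [beamOp]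
  ring

theorem MemW41.integral_mul_D_comm (hL : 0 < L) (hw : MemW41 L w) {k : ℕ} (hk : k ≤ 2)
    (hw₀ : D L k w 0 = 0) (hwL : D L k w L = 0) {κ κ' κ'' : ℝ → ℝ}
    (hκ : ∀ s, HasDerivAt κ (κ' s) s) (hκ' : ∀ s, HasDerivAt κ' (κ'' s) s)
    (hκ'' : Continuous κ'') (hκ₀ : κ 0 = 0) (hκL : κ L = 0) :
    ∫ s in (0 : ℝ)..L, κ s * D L (k + 2) w s = ∫ s in (0 : ℝ)..L, κ'' s * D L k w s := by
  have hκc : Continuous κ := continuous_iff_continuousAt.2 fun s => (hκ s).continuousAt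
  have h := hw.integral_green hL hk hκ hκ' hκ'' le_rfl hL.le le_rfl
  rw [intervalIntegral.integral_sub
      ((hw.intervalIntegrable hL (by lia)).continuousOn_mul hκc.continuousOn)
      ((hw.intervalIntegrable hL (by lia)).continuousOn_mul hκ''.continuousOn),
    hw₀, hwL, hκ₀, hκL] at h
  linarith

theorem integral_unitLoad_mul_beamOp (hL : 0 < L) (hm : 0 < m) (hw : w ∈ hingedW41 L) :
    ∫ s in (0 : ℝ)..L, unitLoad L m s * beamOp L (m ^ 2) w s = ∫ s in (0 : ℝ)..L, w s := by
  obtain ⟨hw, hw₀, hwL, hw₀', hwL'⟩ := hw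
  have hκ (x : ℝ) : HasDerivAt (fun x => x * (L - x) / 2) (L / 2 - x) x := by
    convert! ((hasDerivAt_id x).mul ((hasDerivAt_id x).const_sub L)).div_const 2 using 1
    simp only [id]; ring
  have hint {κ : ℝ → ℝ} (hκ : Continuous κ) {k : ℕ} (hk : k ≤ 4) :
      IntervalIntegrable (fun s => κ s * D L k w s) volume 0 L :=
    (hw.intervalIntegrable hL hk).continuousOn_mul hκ.continuousOn
  calc ∫ s in (0 : ℝ)..L, unitLoad L m s * beamOp L (m ^ 2) w s
      = (∫ s in (0 : ℝ)..L, unitLoad L m s * D L 4 w s) -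
          ∫ s in (0 : ℝ)..L, m ^ 2 * unitLoad L m s * D L 2 w s := by
        rw [← intervalIntegral.integral_sub (hint continuous_unitLoad le_rfl)
          (hint (continuous_unitLoad.const_mul _) (by norm_num))]
        simp only [beamOp]
        congr with s
        ring
    _ = (∫ s in (0 : ℝ)..L, -torsion L m s * D L 2 w s) -
          ∫ s in (0 : ℝ)..L, m ^ 2 * unitLoad L m s * D L 2 w s := by
        rw [hw.integral_mul_D_comm hL le_rfl hw₀' hwL' (hasDerivAt_unitLoad hm)
          (hasDerivAt_unitLoadDeriv hm) continuous_torsion.neg (by simp [unitLoad, torsion_zero])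
          (by simp [unitLoad, torsion_right])]
    _ = -∫ s in (0 : ℝ)..L, s * (L - s) / 2 * D L 2 w s := by
        rw [← intervalIntegral.integral_sub
          (hint (κ := fun s => -torsion L m s) continuous_torsion.neg (by norm_num)) (hint
          (continuous_unitLoad.const_mul _) (by norm_num)), ← intervalIntegral.integral_neg]
        congr with s
        rw [unitLoad]
        field
    _ = ∫ s in (0 : ℝ)..L, w s := by
        rw [hw.integral_mul_D_comm hL (Nat.zero_le 2) (by simpa using hw₀) (by simpa using hwL) hκ
          (fun x => (hasDerivAt_id x).const_sub (L / 2)) continuous_const (by simp) (by simp)]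
        simp

/-- The Green function of `z ↦ -z'' + m² z` on `[0, L]` with Dirichlet conditions. -/
noncomputable def greenKernel (L m x s : ℝ) : ℝ :=
  Real.sinh (m * min x s) * Real.sinh (m * (L - max x s)) / (m * Real.sinh (m * L))

theorem greenKernel_of_le (h : s ≤ x) :
    greenKernel L m x s =
      Real.sinh (m * s) * Real.sinh (m * (L - x)) / (m * Real.sinh (m * L)) := by
  rw [greenKernel, min_eq_right h, max_eq_left h]

theorem greenKernel_of_ge (h : x ≤ s) :
    greenKernel L m x s =
      Real.sinh (m * x) * Real.sinh (m * (L - s)) / (m * Real.sinh (m * L)) := by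
  rw [greenKernel, min_eq_left h, max_eq_right h]

theorem greenKernel_reflect (L m x s : ℝ) :
    greenKernel L m (L - x) (L - s) = greenKernel L m x s := by
  rw [greenKernel, min_sub_sub_left, max_sub_sub_left, sub_sub_cancel, greenKernel,
    mul_comm (Real.sinh (m * min x s))]

theorem continuous_greenKernel : Continuous (greenKernel L m x) := by
  unfold greenKernel
  fun_prop

theorem greenKernel_nonneg (hm : 0 ≤ m) (hx : x ∈ Icc 0 L) (hs : s ∈ Icc 0 L) :
    0 ≤ greenKernel L m x s := by
  have hmin : 0 ≤ min x s := le_min hx.1 hs.1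
  have hmax : 0 ≤ L - max x s := sub_nonneg.2 (max_le hx.2 hs.2)
  have hL : 0 ≤ L := hx.1.trans hx.2
  have h {y : ℝ} (hy : 0 ≤ y) : 0 ≤ Real.sinh (m * y) :=
    Real.sinh_nonneg_iff.2 (mul_nonneg hm hy)
  exact div_nonneg (mul_nonneg (h hmin) (h hmax)) (mul_nonneg hm (h hL))

theorem greenKernel_le (hL : 0 < L) (hm : 0 < m) (hx : x ∈ Icc 0 L) (hs : s ∈ Icc 0 L) :
    greenKernel L m x s ≤ Real.sinh (m * L) / m := by
  have hsinh {y : ℝ} (hy : 0 ≤ y) : 0 ≤ Real.sinh (m * y) :=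
    Real.sinh_nonneg_iff.2 (mul_nonneg hm.le hy)
  have hle {y : ℝ} (hy : y ≤ L) : Real.sinh (m * y) ≤ Real.sinh (m * L) :=
    Real.sinh_le_sinh.2 (mul_le_mul_of_nonneg_left hy hm.le)
  have hmin : min x s ≤ L := (min_le_left x s).trans hx.2
  have hmax : 0 ≤ L - max x s := sub_nonneg.2 (max_le hx.2 hs.2)
  calc greenKernel L m x s
      ≤ Real.sinh (m * L) * Real.sinh (m * L) / (m * Real.sinh (m * L)) :=
        div_le_div_of_nonneg_right (mul_le_mul (hle hmin)
          (hle (sub_le_self L (hx.1.trans (le_max_left x s)))) (hsinh hmax)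
          (hsinh (hx.1.trans hx.2))) (mul_nonneg hm.le (hsinh (hx.1.trans hx.2)))
    _ = Real.sinh (m * L) / m := by
        rw [mul_div_mul_right _ _ (Real.sinh_pos_iff.2 (mul_pos hm hL)).ne']

theorem integral_greenKernel_left (hL : 0 < L) (hw : w ∈ hingedW41 L) (hx : x ∈ Icc 0 L) :
    ∫ s in (0 : ℝ)..x, greenKernel L m x s * beamOp L (m ^ 2) w s =
      Real.sinh (m * (L - x)) / (m * Real.sinh (m * L)) *
        (Real.sinh (m * x) * D L 3 w x - m * Real.cosh (m * x) * D L 2 w x) := by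
  have h := hw.1.integral_sinh_mul_beamOp hL m 0 le_rfl hx.1 hx.2
  simp only [sub_zero, mul_zero, hw.2.2.2.1, Real.sinh_zero, zero_mul] at h
  rw [← h, ← intervalIntegral.integral_const_mul]
  refine intervalIntegral.integral_congr fun s hs => ?_
  rw [uIcc_of_le hx.1] at hs
  simp only [greenKernel_of_le hs.2]
  ring

theorem integral_greenKernel_right (hL : 0 < L) (hw : w ∈ hingedW41 L) (hx : x ∈ Icc 0 L) :
    ∫ s in x..L, greenKernel L m x s * beamOp L (m ^ 2) w s =
      -Real.sinh (m * x) / (m * Real.sinh (m * L)) *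
        (Real.sinh (m * (L - x)) * D L 3 w x + m * Real.cosh (m * (L - x)) * D L 2 w x) := by
  have h := hw.1.integral_sinh_mul_beamOp hL m L hx.1 hx.2 le_rfl
  simp only [sub_self, mul_zero, hw.2.2.2.2, Real.sinh_zero, zero_mul, zero_sub] at h
  rw [← neg_sub L x, mul_neg, Real.sinh_neg, Real.cosh_neg] at h
  calc _ = -Real.sinh (m * x) / (m * Real.sinh (m * L)) *
        ∫ s in x..L, Real.sinh (m * (s - L)) * beamOp L (m ^ 2) w s := by
        rw [← intervalIntegral.integral_const_mul]
        refine intervalIntegral.integral_congr fun s hs => ?_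
        rw [uIcc_of_le hx.2] at hs
        simp only [greenKernel_of_ge hs.1]
        rw [← neg_sub L s, mul_neg, Real.sinh_neg]
        ring
    _ = _ := by rw [h]; ring

theorem neg_D_two_eq_integral_greenKernel (hL : 0 < L) (hm : 0 < m) (hw : w ∈ hingedW41 L)
    (hx : x ∈ Icc 0 L) :
    -D L 2 w x = ∫ s in (0 : ℝ)..L, greenKernel L m x s * beamOp L (m ^ 2) w s := by
  have hS : Real.sinh (m * L) ≠ 0 := (Real.sinh_pos_iff.2 (mul_pos hm hL)).ne'
  have hadd : Real.sinh (m * L) = Real.sinh (m * x) * Real.cosh (m * (L - x)) +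
      Real.cosh (m * x) * Real.sinh (m * (L - x)) := by
    rw [← Real.sinh_add]; ring_nf
  have hint : IntervalIntegrable (fun s => greenKernel L m x s * beamOp L (m ^ 2) w s)
      volume 0 L :=
    (hw.1.intervalIntegrable_beamOp hL (m ^ 2)).continuousOn_mul
      continuous_greenKernel.continuousOn
  rw [← intervalIntegral.integral_add_adjacent_intervals (b := x)
    (hint.mono_set (by grind [uIcc_of_le])) (hint.mono_set (by grind [uIcc_of_le])),
    integral_greenKernel_left hL hw hx, integral_greenKernel_right hL hw hx]
  field_simp
  rw [hadd]
  ring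

theorem torsion_mul_unitLoad_le (hL : 0 < L) (hm : 0 < m) (hx : x ∈ Icc 0 L) (hs : s ∈ Icc 0 L) :
    torsion L m x * unitLoad L m s ≤
      Real.sinh (m * L / 2) ^ 2 * torsionalRigidity L m / m ^ 2 * greenKernel L m x s := by
  wlog h : s ≤ x generalizing x s
  · have hreflect {y : ℝ} (hy : y ∈ Icc 0 L) : L - y ∈ Icc 0 L :=
      ⟨sub_nonneg.2 hy.2, sub_le_self L hy.1⟩
    rw [← greenKernel_reflect, ← torsion_symm, ← unitLoad_symm L m s]
    exact this (hreflect hx) (hreflect hs) (sub_le_sub_left (le_of_not_ge h) L)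
  have hS : Real.sinh (m * L / 2) ≠ 0 := (Real.sinh_pos_iff.2 (by positivity)).ne'
  have hsinh : Real.sinh (m * L) = 2 * Real.sinh (m * L / 2) * Real.cosh (m * L / 2) := by
    rw [← Real.sinh_two_mul]; ring_nf
  calc torsion L m x * unitLoad L m s
      ≤ Real.tanh (m * L / 2) * Real.sinh (m * (L - x)) / m ^ 2 *
        (torsionalRigidity L m / (2 * m) * Real.sinh (m * s)) := by
        rw [← torsion_symm]
        exact mul_le_mul (torsion_le hm _) (unitLoad_le hm hs) (unitLoad_nonneg hm hs)
          ((torsion_nonneg m ⟨sub_nonneg.2 hx.2, sub_le_self L hx.1⟩).trans (torsion_le hm _))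
    _ = _ := by
        rw [greenKernel_of_le h, hsinh, Real.tanh_eq_sinh_div_cosh]
        field

end GreenFunction

section InverseMonotonicity

variable {L m M N x : ℝ} {u v w : ℝ → ℝ}

theorem D_two_nonpos_of_beamOp_nonneg (hL : 0 < L) (hm : 0 < m) (hw : w ∈ hingedW41 L)
    (hpos : ∀ᵐ x, x ∈ Ioo 0 L → 0 ≤ beamOp L (m ^ 2) w x) (hx : x ∈ Icc 0 L) :
    D L 2 w x ≤ 0 := by
  rw [← neg_nonneg, neg_D_two_eq_integral_greenKernel hL hm hw hx]
  refine intervalIntegral.integral_nonneg_of_ae_restrict hL.le ?_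
  filter_upwards [ae_restrict_Icc hpos, ae_restrict_mem measurableSet_Icc] with s hs hmem
  exact mul_nonneg (greenKernel_nonneg hm.le hx hmem) hs

theorem torsion_mul_integral_le (hL : 0 < L) (hm : 0 < m) (hw : w ∈ hingedW41 L)
    (hpos : ∀ᵐ x, x ∈ Ioo 0 L → 0 ≤ beamOp L (m ^ 2) w x) (hx : x ∈ Icc 0 L) :
    torsion L m x * ∫ s in (0 : ℝ)..L, w s ≤
      Real.sinh (m * L / 2) ^ 2 * torsionalRigidity L m / m ^ 2 * -D L 2 w x := by
  have hint {κ : ℝ → ℝ} (hκ : Continuous κ) :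
      IntervalIntegrable (fun s => κ s * beamOp L (m ^ 2) w s) volume 0 L :=
    (hw.1.intervalIntegrable_beamOp hL (m ^ 2)).continuousOn_mul hκ.continuousOn
  rw [neg_D_two_eq_integral_greenKernel hL hm hw hx, ← integral_unitLoad_mul_beamOp hL hm hw,
    ← intervalIntegral.integral_const_mul, ← intervalIntegral.integral_const_mul]
  refine intervalIntegral.integral_mono_ae_restrict hL.le
    ((hint continuous_unitLoad).const_mul _) ((hint continuous_greenKernel).const_mul _) ?_
  filter_upwards [ae_restrict_Icc hpos, ae_restrict_mem measurableSet_Icc] with s hs hmem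
  simp only [← mul_assoc]
  exact mul_le_mul_of_nonneg_right (torsion_mul_unitLoad_le hL hm hx hmem) hs

theorem abs_D_two_le (hL : 0 < L) (hm : 0 < m) (hw : w ∈ hingedW41 L) (hx : x ∈ Icc 0 L) :
    |D L 2 w x| ≤ Real.sinh (m * L) / m * ∫ s in (0 : ℝ)..L, |beamOp L (m ^ 2) w s| := by
  rw [← abs_neg, neg_D_two_eq_integral_greenKernel hL hm hw hx, ← Real.norm_eq_abs,
    ← intervalIntegral.integral_const_mul]
  refine intervalIntegral.norm_integral_le_of_norm_le hL.le (.of_forall fun s hs => ?_)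
    ((hw.1.intervalIntegrable_beamOp hL (m ^ 2)).abs.const_mul _)
  have hs' : s ∈ Icc 0 L := Ioc_subset_Icc_self hs
  rw [Real.norm_eq_abs, abs_mul, abs_of_nonneg (greenKernel_nonneg hm.le hx hs')]
  exact mul_le_mul_of_nonneg_right (greenKernel_le hL hm hx hs') (abs_nonneg _)

theorem sigma_eq (hm : 0 < m) :
    σ (m * L) =
      L ^ 3 / (4 * (Real.cosh (m * L / 2) ^ 2 * torsionalRigidity L m - L ^ 3 / 12)) := by
  have hcosh : Real.cosh (m * L) = 2 * Real.cosh (m * L / 2) ^ 2 - 1 := by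
    rw [show m * L = 2 * (m * L / 2) by ring, Real.cosh_two_mul, Real.sinh_sq]; ring_nf
  have hsinh : Real.sinh (m * L) = 2 * Real.sinh (m * L / 2) * Real.cosh (m * L / 2) := by
    rw [← Real.sinh_two_mul]; ring_nf
  have hden : 6 * (m * L) * Real.cosh (m * L) + 6 * (m * L) - 12 * Real.sinh (m * L) -
      (m * L) ^ 3 = 3 * m ^ 3 *
        (4 * (Real.cosh (m * L / 2) ^ 2 * torsionalRigidity L m - L ^ 3 / 12)) := by
    rw [torsionalRigidity_eq hm, Real.tanh_eq_sinh_div_cosh, hcosh, hsinh]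
    field
  rw [σ, hden, mul_pow, ← mul_assoc, mul_div_mul_left _ _ (by positivity)]

theorem mul_sinh_sq_mul_torsionalRigidity_le (hL : 0 < L) (hm : 0 < m) (hN : 0 ≤ N)
    (hmN : N ≤ 4 * m ^ 2 / L ^ 3 * σ (m * L)) :
    N * (Real.sinh (m * L / 2) ^ 2 * torsionalRigidity L m / m ^ 2) ≤
      1 + N * ∫ x in (0 : ℝ)..L, unitLoad L m x := by
  have hcosh := Real.cosh_sq (m * L / 2)
  set X := Real.cosh (m * L / 2) ^ 2 * torsionalRigidity L m - L ^ 3 / 12 with hX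
  have hNX : N * X ≤ m ^ 2 := by
    rcases le_or_gt X 0 with h | h
    · exact (mul_nonpos_of_nonneg_of_nonpos hN h).trans (sq_nonneg m)
    · rw [← le_div_iff₀ h]
      refine hmN.trans_eq ?_
      rw [sigma_eq hm, ← hX]
      field
  rw [integral_unitLoad, ← sub_nonneg]
  calc 0 ≤ (m ^ 2 - N * X) / m ^ 2 := div_nonneg (sub_nonneg.2 hNX) (sq_nonneg m)
    _ = _ := by rw [hX, hcosh]; field

theorem one_add_mul_integral_unitLoad_pos (hL : 0 ≤ L) (hm : 0 < m) (hN : 0 ≤ N) :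
    0 < 1 + N * ∫ x in (0 : ℝ)..L, unitLoad L m x :=
  add_pos_of_pos_of_nonneg one_pos <| mul_nonneg hN <|
    intervalIntegral.integral_nonneg hL fun _ hx => unitLoad_nonneg hm hx

theorem D_two_nonpos_of_G_nonneg (hL : 0 < L) (hm : 0 < m) (hN : 0 ≤ N)
    (hmN : N ≤ 4 * m ^ 2 / L ^ 3 * σ (m * L)) (hw : w ∈ hingedW41 L)
    (hpos : ∀ᵐ x, x ∈ Ioo 0 L → 0 ≤ G L (m ^ 2) N w x) (hx : x ∈ Icc 0 L) :
    D L 2 w x ≤ 0 := by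
  have hψ := unitLoad_mem_hingedW41 hL hm
  obtain ⟨-, hψ₂, -⟩ := memW41_unitLoad hL hm
  set I := ∫ s in (0 : ℝ)..L, w s
  set P := ∫ s in (0 : ℝ)..L, unitLoad L m s
  -- Adding a multiple of the unit load absorbs the nonlocal term: `beamOp v = G w`.
  let v := w + (N * I) • unitLoad L m
  have hv : v ∈ hingedW41 L := add_smul_mem_hingedW41 hL hw hψ _
  have hbeam : ∀ᵐ x, x ∈ Ioo 0 L → 0 ≤ beamOp L (m ^ 2) v x := by
    filter_upwards [hpos, hw.1.beamOp_add_smul hL hψ.1 (m ^ 2) (N * I)] with x h hadd hx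
    rw [hadd hx, beamOp_unitLoad hL hm hx, mul_one]
    exact h hx
  have hv₂ : D L 2 v x = D L 2 w x - N * I * torsion L m x := by
    rw [hw.1.D_two_add_smul hL hψ.1 _ hx, hψ₂ hx, Pi.neg_apply]
    ring
  have hvI : ∫ s in (0 : ℝ)..L, v s = I * (1 + N * P) := by
    rw [hw.1.integral_add_smul hL hψ.1]
    ring
  have hconc : 0 ≤ -D L 2 v x := neg_nonneg.2 (D_two_nonpos_of_beamOp_nonneg hL hm hv hbeam hx)
  have hNP : 0 < 1 + N * P := one_add_mul_integral_unitLoad_pos hL.le hm hN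
  refine nonpos_of_mul_nonpos_right (?_ : (1 + N * P) * D L 2 w x ≤ 0) hNP
  suffices (1 + N * P) * (N * I * torsion L m x) ≤ (1 + N * P) * -D L 2 v x by
    rw [hv₂] at this
    linarith
  calc (1 + N * P) * (N * I * torsion L m x)
      = N * (torsion L m x * ∫ s in (0 : ℝ)..L, v s) := by rw [hvI]; ring
    _ ≤ N * (Real.sinh (m * L / 2) ^ 2 * torsionalRigidity L m / m ^ 2 * -D L 2 v x) :=
        mul_le_mul_of_nonneg_left (torsion_mul_integral_le hL hm hv hbeam hx) hN
    _ ≤ (1 + N * P) * -D L 2 v x := by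
        rw [← mul_assoc]
        exact mul_le_mul_of_nonneg_right (mul_sinh_sq_mul_torsionalRigidity_le hL hm hN hmN) hconc

theorem nonneg_of_D_two_nonpos (hL : 0 < L) (hw : w ∈ hingedW41 L)
    (hconc : ∀ x ∈ Icc 0 L, D L 2 w x ≤ 0) (hx : x ∈ Icc 0 L) : 0 ≤ w x := by
  obtain ⟨hw, hw₀, hwL, -⟩ := hw
  rw [← D_zero L w] at hw₀ hwL ⊢
  exact nonneg_of_hasDerivAt2_nonpos (hw.continuousOn hL (by norm_num))
    (fun x hx => hw.hasDerivAt hL (by norm_num) hx) (fun x hx => hw.hasDerivAt hL (by norm_num) hx)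
    (fun x hx => hconc x (Ioo_subset_Icc_self hx)) hw₀.ge hwL.ge hx

/-- The operator `G` with hinged ends is inverse monotone with respect to `Precedes`, the order
`u ≤ v`, `u'' ≥ v''`. -/
def InverseMonotone (L M N : ℝ) : Prop :=
  ∀ ⦃u v⦄, u ∈ hingedW41 L → v ∈ hingedW41 L →
    (∀ᵐ x, x ∈ Ioo 0 L → G L M N u x ≤ G L M N v x) → Precedes L u v

theorem inverseMonotone_of_le_sigma (hL : 0 < L) (hM : 0 < M) (hN : 0 ≤ N)
    (hMN : N ≤ 4 * M / L ^ 3 * σ (√M * L)) : InverseMonotone L M N := by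
  intro u v hu hv hG
  rw [← Real.sq_sqrt hM.le] at hMN hG
  rw [Real.sqrt_sq (Real.sqrt_nonneg M)] at hMN
  have hdiff : v + (-1 : ℝ) • u ∈ hingedW41 L := add_smul_mem_hingedW41 hL hv hu (-1)
  have hpos : ∀ᵐ x, x ∈ Ioo 0 L → 0 ≤ G L (√M ^ 2) N (v + (-1 : ℝ) • u) x := by
    filter_upwards [hG, hv.1.G_add_smul hL hu.1 (√M ^ 2) N (-1)] with x h hadd hx
    rw [hadd hx]
    linarith [h hx]
  have hconc (x) (hx : x ∈ Icc 0 L) :=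
    D_two_nonpos_of_G_nonneg hL (Real.sqrt_pos.2 hM) hN hMN hdiff hpos hx
  intro x hx
  have h₀ := nonneg_of_D_two_nonpos hL hdiff hconc hx
  have h₂ := hconc x hx
  rw [hv.1.D_two_add_smul hL hu.1 (-1) hx] at h₂
  simp only [Pi.add_apply, Pi.smul_apply, smul_eq_mul] at h₀
  constructor <;> linarith

end InverseMonotonicity

section Solvability

variable {L m M N : ℝ} {q g : ℝ → ℝ}

theorem hasDerivAt_integral_of_continuous (hq : Continuous q) (x : ℝ) :
    HasDerivAt (fun y => ∫ s in (0 : ℝ)..y, q s) (q x) x :=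
  intervalIntegral.integral_hasDerivAt_right (hq.intervalIntegrable _ _)
    (hq.stronglyMeasurableAtFilter _ _) hq.continuousAt

theorem exists_hasDerivAt_sub_const (hL : L ≠ 0) (hq : Continuous q) :
    ∃ (U : ℝ → ℝ) (c : ℝ), U 0 = 0 ∧ U L = 0 ∧ ∀ x, HasDerivAt U (q x - c) x := by
  let U (x : ℝ) := ∫ s in (0 : ℝ)..x, q s
  refine ⟨fun x => U x - U L / L * x, U L / L, by simp [U], ?_, fun x => ?_⟩
  · field_simp
    ring
  · convert! (hasDerivAt_integral_of_continuous hq x).sub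
      ((hasDerivAt_id x).const_mul (U L / L)) using 1
    ring

theorem exists_hasDerivAt2_eq_add (hL : 0 < L) (hm : 0 < m) (hq : Continuous q) :
    ∃ y y' : ℝ → ℝ, y 0 = 0 ∧ y L = 0 ∧ (∀ x, HasDerivAt y (y' x) x) ∧
      ∀ x, HasDerivAt y' (m ^ 2 * y x + q x) x := by
  let C (x : ℝ) := ∫ s in (0 : ℝ)..x, Real.cosh (m * s) * q s
  let S (x : ℝ) := ∫ s in (0 : ℝ)..x, Real.sinh (m * s) * q s
  have hsinhL : Real.sinh (m * L) ≠ 0 := (Real.sinh_pos_iff.2 (mul_pos hm hL)).ne'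
  have hC (x) : HasDerivAt C (Real.cosh (m * x) * q x) x :=
    hasDerivAt_integral_of_continuous (by fun_prop) x
  have hS (x) : HasDerivAt S (Real.sinh (m * x) * q x) x :=
    hasDerivAt_integral_of_continuous (by fun_prop) x
  have hsinh (x) : HasDerivAt (fun x => Real.sinh (m * x)) (m * Real.cosh (m * x)) x := by
    simpa using hasDerivAt_sinh_mul_sub m 0 x
  have hcosh (x) : HasDerivAt (fun x => Real.cosh (m * x)) (m * Real.sinh (m * x)) x := by
    simpa using hasDerivAt_cosh_mul_sub m 0 x
  -- Variation of parameters gives a particular solution with zero Cauchy data at `0`.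
  let Y (x : ℝ) := (Real.sinh (m * x) * C x - Real.cosh (m * x) * S x) / m
  let A := -Y L / Real.sinh (m * L)
  refine ⟨fun x => Y x + A * Real.sinh (m * x),
    fun x => Real.cosh (m * x) * C x - Real.sinh (m * x) * S x + A * (m * Real.cosh (m * x)),
    by simp [Y, S], ?_, fun x => ?_, fun x => ?_⟩
  · simp only [A]
    field
  · convert! ((((hsinh x).mul (hC x)).sub ((hcosh x).mul (hS x))).div_const m).add
      ((hsinh x).const_mul A) using 1
    field
  · convert! (((hcosh x).mul (hC x)).sub ((hsinh x).mul (hS x))).add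
      (((hcosh x).const_mul m).const_mul A) using 1
    simp only [Y]
    field_simp
    linear_combination -q x * Real.cosh_sq_sub_sinh_sq (m * x)

theorem exists_continuous_primitive (hL : 0 ≤ L) (hg : IntervalIntegrable g volume 0 L) :
    ∃ P : ℝ → ℝ, Continuous P ∧ AbsolutelyContinuousOnInterval P 0 L ∧
      ∀ᵐ x, x ∈ Ioo 0 L → HasDerivAt P (g x) x := by
  let g₀ := indicator (Ioc 0 L) g
  have hg₀ : Integrable g₀ := by
    rw [integrable_indicator_iff measurableSet_Ioc]
    exact (intervalIntegrable_iff_integrableOn_Ioc_of_le hL).1 hg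
  refine ⟨fun x => ∫ s in (0 : ℝ)..x, g₀ s,
    intervalIntegral.continuous_primitive (fun _ _ => hg₀.intervalIntegrable) 0,
    hg₀.intervalIntegrable.absolutelyContinuousOnInterval_intervalIntegral left_mem_uIcc, ?_⟩
  filter_upwards [hg₀.intervalIntegrable.ae_hasDerivAt_integral (a := 0) (b := L)] with x h hx
  have hd := h (by rw [uIcc_of_le hL]; exact Ioo_subset_Icc_self hx) 0 left_mem_uIcc
  rwa [show g₀ x = g x from indicator_of_mem (Ioo_subset_Ioc_self hx) g] at hd

theorem exists_beamOp_eq (hL : 0 < L) (hm : 0 < m) (hg : IntervalIntegrable g volume 0 L) :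
    ∃ w ∈ hingedW41 L, ∀ᵐ x, x ∈ Ioo 0 L → beamOp L (m ^ 2) w x = g x := by
  obtain ⟨P, hP, hPac, hP'⟩ := exists_continuous_primitive hL.le hg
  -- With `q'' = g` and `y'' = m² (y + q)`, the sum `z = y + q` solves `z'' - m² z = g`.
  obtain ⟨q, c, hq₀, hqL, hq⟩ := exists_hasDerivAt_sub_const hL.ne' hP
  have hqc : Continuous q := continuous_iff_continuousAt.2 fun x => (hq x).continuousAt
  obtain ⟨y, y', hy₀, hyL, hy, hy'⟩ := exists_hasDerivAt2_eq_add hL hm (hqc.const_mul (m ^ 2))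
  have hyc : Continuous y := continuous_iff_continuousAt.2 fun x => (hy x).continuousAt
  have hV := hasDerivAt_integral_of_continuous (hyc.add hqc)
  obtain ⟨w, d, hw₀, hwL, hw⟩ := exists_hasDerivAt_sub_const hL.ne'
    (continuous_iff_continuousAt.2 fun x => (hV x).continuousAt)
  have hy'ac : AbsolutelyContinuousOnInterval y' 0 L :=
    absolutelyContinuousOnInterval_of_hasDerivWithinAt hL (fun x _ => (hy' x).hasDerivWithinAt)
      (by fun_prop)
  have hPcac : AbsolutelyContinuousOnInterval (fun x => P x - c) 0 L :=
    hPac.fun_sub (contDiffOn_const (n := 1)).absolutelyContinuousOnInterval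
  obtain ⟨hmem, h₂, h₃⟩ := memW41_of_hasDerivWithinAt hL (fun x _ => (hw x).hasDerivWithinAt)
    (fun x _ => ((hV x).sub_const d).hasDerivWithinAt)
    (fun x _ => ((hy x).add (hq x)).hasDerivWithinAt) (hy'ac.fun_add hPcac)
  refine ⟨w, ⟨hmem, hw₀, hwL, ?_, ?_⟩, ?_⟩
  · simp [h₂ (left_mem_Icc.2 hL.le), hy₀, hq₀]
  · simp [h₂ (right_mem_Icc.2 hL.le), hyL, hqL]
  · filter_upwards [hP'] with x h hx
    rw [beamOp, D_succ_eq_of_hasDerivAt h₃ hx ((hy' x).add ((h hx).sub_const c)),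
      h₂ (Ioo_subset_Icc_self hx), Pi.add_apply]
    ring

theorem exists_G_eq (hL : 0 < L) (hM : 0 < M) (hN : 0 ≤ N)
    (hg : IntervalIntegrable g volume 0 L) :
    ∃ w ∈ hingedW41 L, ∀ᵐ x, x ∈ Ioo 0 L → G L M N w x = g x := by
  obtain ⟨m, hm, rfl⟩ : ∃ m, 0 < m ∧ M = m ^ 2 :=
    ⟨√M, Real.sqrt_pos.2 hM, (Real.sq_sqrt hM.le).symm⟩
  obtain ⟨v, hv, hvg⟩ := exists_beamOp_eq hL hm hg
  have hψ := unitLoad_mem_hingedW41 hL hm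
  set P := ∫ s in (0 : ℝ)..L, unitLoad L m s with hP
  have hNP : 0 < 1 + N * P := one_add_mul_integral_unitLoad_pos hL.le hm hN
  let I := (∫ s in (0 : ℝ)..L, v s) / (1 + N * P)
  refine ⟨v + (-(N * I)) • unitLoad L m, add_smul_mem_hingedW41 hL hv hψ _, ?_⟩
  filter_upwards [hvg, hv.1.beamOp_add_smul hL hψ.1 (m ^ 2) (-(N * I))] with x h hadd hx
  change beamOp L (m ^ 2) _ x + N * _ = g x
  rw [hadd hx, h hx, beamOp_unitLoad hL hm hx, hv.1.integral_add_smul hL hψ.1, ← hP]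
  simp only [I]
  field

end Solvability

section Convergence

variable {L a b c m M N K x : ℝ} {p u v w h : ℝ → ℝ} {y z : ℕ → ℝ → ℝ}

theorem abs_le_of_abs_D_two_le (hL : 0 < L) (hw : w ∈ hingedW41 L)
    (hK : ∀ x ∈ Icc 0 L, |D L 2 w x| ≤ K) (hx : x ∈ Icc 0 L) : |w x| ≤ K * L ^ 2 / 8 := by
  obtain ⟨hw, hw₀, hwL, -⟩ := hw
  -- Compare with the parabola `K x (L - x) / 2`, whose second derivative is `-K`.
  have hcomp {σ : ℝ} (hσ : ∀ x ∈ Icc 0 L, σ * D L 2 w x ≤ K) :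
      0 ≤ K * (x * (L - x)) / 2 + σ * w x := by
    refine nonneg_of_hasDerivAt2_nonpos (a := 0) (b := L)
      (w := fun x => K * (x * (L - x)) / 2 + σ * w x)
      (w' := fun x => K * (L - 2 * x) / 2 + σ * D L 1 w x) (w'' := fun x => -K + σ * D L 2 w x)
      ?_ (fun x hx => ?_) (fun x hx => ?_) (fun x hx => ?_) (by simp [hw₀]) (by simp [hwL]) hx
    · exact Continuous.continuousOn (by fun_prop) |>.add (hw.1.continuousOn.const_mul σ)
    · have hd := hw.hasDerivAt hL (k := 0) (by norm_num) hx
      rw [D_zero] at hd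
      convert! ((((hasDerivAt_id x).mul ((hasDerivAt_id x).const_sub L)).const_mul K).div_const
        2).add (hd.const_mul σ) using 1
      simp only [id]
      ring
    · have hd := hw.hasDerivAt hL (k := 1) (by norm_num) hx
      convert! (((((hasDerivAt_id x).const_mul 2).const_sub L).const_mul K).div_const 2).add
        (hd.const_mul σ) using 1
      ring
    · linarith [hσ x (Ioo_subset_Icc_self hx)]
  have hup := hcomp (σ := -1) fun x hx => by linarith [neg_le_of_abs_le (hK x hx)]
  have hlo := hcomp (σ := 1) fun x hx => by linarith [le_of_abs_le (hK x hx)]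
  have hK₀ : 0 ≤ K := (abs_nonneg _).trans (hK x hx)
  have hpar : K * (x * (L - x)) / 2 ≤ K * L ^ 2 / 8 := by
    nlinarith [mul_nonneg hK₀ (sq_nonneg (L - 2 * x))]
  exact abs_le.2 ⟨by linarith, by linarith⟩

theorem tendstoUniformlyOn_of_abs_sub_le {s : Set ℝ} {ε : ℕ → ℝ} (hε : Tendsto ε atTop (𝓝 0))
    (h : ∀ n, ∀ x ∈ s, |y n x - w x| ≤ ε n) : TendstoUniformlyOn y w atTop s := by
  rw [Metric.tendstoUniformlyOn_iff]
  intro δ hδ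
  filter_upwards [hε.eventually_lt_const hδ] with n hn x hx
  rw [dist_comm, Real.dist_eq]
  exact (h n x hx).trans_lt hn

theorem tendstoUniformlyOn_of_succ {s : Set ℝ}
    (h : TendstoUniformlyOn (fun n => y (n + 1)) w atTop s) : TendstoUniformlyOn y w atTop s :=
  fun t ht => by
    rw [← map_add_atTop_eq_nat 1]
    exact h t ht

theorem intervalIntegrable_and_tendsto_integral_abs_sub (hab : a ≤ b)
    (hz : ∀ n, IntervalIntegrable (z n) volume a b) (hK : ∀ n, ∀ x ∈ Icc a b, |z n x| ≤ K)
    (hlim : ∀ x ∈ Icc a b, Tendsto (fun n => z n x) atTop (𝓝 (h x))) :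
    IntervalIntegrable h volume a b ∧
      Tendsto (fun n => ∫ x in a..b, |z n x - h x|) atTop (𝓝 0) := by
  have hsub : uIoc a b ⊆ Icc a b := by rw [uIoc_of_le hab]; exact Ioc_subset_Icc_self
  have hhK : ∀ x ∈ Icc a b, |h x| ≤ K := fun x hx =>
    le_of_tendsto' (hlim x hx).abs fun n => hK n x hx
  have hmeas : AEStronglyMeasurable h (volume.restrict (uIoc a b)) :=
    aestronglyMeasurable_of_tendsto_ae atTop (fun n => (hz n).aestronglyMeasurable_restrict_uIoc)
      (ae_restrict_of_forall_mem measurableSet_uIoc fun x hx => hlim x (hsub hx))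
  have hh : IntervalIntegrable h volume a b :=
    (intervalIntegrable_const (c := K)).mono_fun' hmeas
      (ae_restrict_of_forall_mem measurableSet_uIoc fun x hx => hhK x (hsub hx))
  refine ⟨hh, ?_⟩
  rw [← intervalIntegral.integral_zero (a := a) (b := b) (μ := volume)]
  refine intervalIntegral.tendsto_integral_filter_of_dominated_convergence (fun _ => K + K)
    (.of_forall fun n => ((hz n).sub hh).abs.aestronglyMeasurable_restrict_uIoc)
    (.of_forall fun n => .of_forall fun x hx => ?_) intervalIntegrable_const
    (.of_forall fun x hx => ?_)
  · rw [Real.norm_eq_abs, abs_abs]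
    exact (abs_sub _ _).trans (add_le_add (hK n x (hsub hx)) (hhK x (hsub hx)))
  · simpa using ((hlim x (hsub hx)).sub_const (h x)).abs

/-- Convergence in `C²[0, L]`: uniform convergence together with the second derivatives. -/
def TendstoC2 (L : ℝ) (y : ℕ → ℝ → ℝ) (v : ℝ → ℝ) : Prop :=
  TendstoUniformlyOn y v atTop (Icc 0 L) ∧
    TendstoUniformlyOn (fun n => D L 2 (y n)) (D L 2 v) atTop (Icc 0 L)

theorem tendstoC2_of_tendsto_integral_abs_beamOp_sub (hL : 0 < L) (hm : 0 < m)
    (hy : ∀ n, y n ∈ hingedW41 L) (hv : v ∈ hingedW41 L)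
    (hlim : Tendsto (fun n => ∫ x in (0 : ℝ)..L, |beamOp L (m ^ 2) (y n) x - beamOp L (m ^ 2) v x|)
      atTop (𝓝 0)) : TendstoC2 L y v := by
  let ε (n : ℕ) := Real.sinh (m * L) / m *
    ∫ x in (0 : ℝ)..L, |beamOp L (m ^ 2) (y n) x - beamOp L (m ^ 2) v x|
  have hε : Tendsto ε atTop (𝓝 0) := by simpa using hlim.const_mul (Real.sinh (m * L) / m)
  have hdiff (n) : y n + (-1 : ℝ) • v ∈ hingedW41 L := add_smul_mem_hingedW41 hL (hy n) hv (-1)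
  have hbound (n) : ∀ x ∈ Icc 0 L, |D L 2 (y n + (-1 : ℝ) • v) x| ≤ ε n := fun x hx => by
    refine (abs_D_two_le hL hm (hdiff n) hx).trans_eq ?_
    congr 1
    refine intervalIntegral.integral_congr_ae_restrict (ae_restrict_uIoc hL.le ?_)
    filter_upwards [(hy n).1.beamOp_add_smul hL hv.1 (m ^ 2) (-1)] with s hs hmem
    rw [hs hmem, neg_one_mul, sub_eq_add_neg]
  refine ⟨tendstoUniformlyOn_of_abs_sub_le (ε := fun n => ε n * L ^ 2 / 8) ?_ fun n x hx => ?_,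
    tendstoUniformlyOn_of_abs_sub_le hε fun n x hx => ?_⟩
  · simpa using (hε.mul_const (L ^ 2)).div_const 8
  · simpa [sub_eq_add_neg] using abs_le_of_abs_D_two_le hL (hdiff n) (hbound n) hx
  · have := hbound n x hx
    rwa [(hy n).1.D_two_add_smul hL hv.1 _ hx, neg_one_mul, ← sub_eq_add_neg] at this

theorem exists_tendstoC2_of_beamOp_eq (hL : 0 < L) (hm : 0 < m)
    (hp : IntervalIntegrable p volume 0 L) (hy : ∀ n, y n ∈ hingedW41 L)
    (hyz : ∀ n, ∀ᵐ x, x ∈ Ioo 0 L → beamOp L (m ^ 2) (y n) x = p x + z n x)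
    (hz : ∀ n, IntervalIntegrable (z n) volume 0 L) (hK : ∀ n, ∀ x ∈ Icc 0 L, |z n x| ≤ K)
    (hlim : ∀ x ∈ Icc 0 L, Tendsto (fun n => z n x) atTop (𝓝 (h x))) :
    ∃ v ∈ hingedW41 L, (∀ᵐ x, x ∈ Ioo 0 L → beamOp L (m ^ 2) v x = p x + h x) ∧
      TendstoC2 L y v := by
  obtain ⟨hh, hzh⟩ := intervalIntegrable_and_tendsto_integral_abs_sub hL.le hz hK hlim
  obtain ⟨v, hv, hvh⟩ := exists_beamOp_eq hL hm (hp.add hh)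
  refine ⟨v, hv, hvh, tendstoC2_of_tendsto_integral_abs_beamOp_sub hL hm hy hv ?_⟩
  refine hzh.congr fun n => intervalIntegral.integral_congr_ae_restrict
    (ae_restrict_uIoc hL.le ?_)
  filter_upwards [hyz n, hvh] with x hn hx hmem
  rw [hn hmem, hx hmem, add_sub_add_left_eq_sub]

theorem IsStep.beamOp_eq (hv : IsStep L a b c M N p u v) :
    ∀ᵐ x, x ∈ Ioo 0 L → beamOp L M v x = p x +
      ((a + b * (∫ t in (0 : ℝ)..L, u t) - M) * D L 2 u x +
        ((N - c) * (∫ t in (0 : ℝ)..L, u t) - N * ∫ t in (0 : ℝ)..L, v t)) := by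
  filter_upwards [hv.2.2] with x h hx
  have h := h hx
  simp only [G, f] at h
  rw [beamOp]
  linear_combination h

theorem IsIteration.memW41 (hu : MemW41 L u) (hy : IsIteration L a b c M N p u y) (n : ℕ) :
    MemW41 L (y n) := by
  cases n with
  | zero => exact hy.1 ▸ hu
  | succ n => exact (hy.2 n).1

theorem IsIteration.exists_tendstoC2 (hL : 0 < L) (hM : 0 < M)
    (hp : IntervalIntegrable p volume 0 L) (hu : MemW41 L u)
    (hy : IsIteration L a b c M N p u y) {I : ℝ} {ζ : ℝ → ℝ}
    (hK : ∀ n, ∀ x ∈ Icc 0 L, |D L 2 (y n) x| ≤ K)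
    (hζ : ∀ x ∈ Icc 0 L, Tendsto (fun n => D L 2 (y n) x) atTop (𝓝 (ζ x)))
    (hI : Tendsto (fun n => ∫ x in (0 : ℝ)..L, y n x) atTop (𝓝 I)) :
    ∃ v ∈ hingedW41 L,
      (∀ᵐ x, x ∈ Ioo 0 L → beamOp L M v x = p x + ((a + b * I - M) * ζ x - c * I)) ∧
      TendstoC2 L y v := by
  obtain ⟨m, hm, rfl⟩ : ∃ m, 0 < m ∧ M = m ^ 2 :=
    ⟨√M, Real.sqrt_pos.2 hM, (Real.sq_sqrt hM.le).symm⟩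
  let J (n : ℕ) := ∫ x in (0 : ℝ)..L, y n x
  let A (n : ℕ) := a + b * J n - m ^ 2
  let R (n : ℕ) := (N - c) * J n - N * J (n + 1)
  have hA : Tendsto A atTop (𝓝 (a + b * I - m ^ 2)) :=
    ((hI.const_mul b).const_add a).sub_const _
  have hR : Tendsto R atTop (𝓝 (-(c * I))) := by
    convert (hI.const_mul (N - c)).sub (((tendsto_add_atTop_iff_nat 1).2 hI).const_mul N) using 2
    ring
  obtain ⟨CA, hCA⟩ := (Metric.isBounded_range_of_tendsto _ hA).exists_norm_le
  obtain ⟨CR, hCR⟩ := (Metric.isBounded_range_of_tendsto _ hR).exists_norm_le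
  have hbound (n) (x) (hx : x ∈ Icc 0 L) : |A n * D L 2 (y n) x + R n| ≤ CA * K + CR := by
    have hAn := hCA _ (mem_range_self n)
    calc |A n * D L 2 (y n) x + R n| ≤ |A n| * |D L 2 (y n) x| + |R n| := by
          rw [← abs_mul]; exact abs_add_le _ _
      _ ≤ CA * K + CR := add_le_add
          (mul_le_mul hAn (hK n x hx) (abs_nonneg _) ((norm_nonneg _).trans hAn))
          (hCR _ (mem_range_self n))
  obtain ⟨v, hv, hvζ, hlim⟩ := exists_tendstoC2_of_beamOp_eq hL hm hp
    (fun n => ⟨(hy.2 n).1, (hy.2 n).2.1⟩) (fun n => (hy.2 n).beamOp_eq)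
    (fun n => (((hy.memW41 hu n).intervalIntegrable hL (by norm_num)).const_mul (A n)).add
      intervalIntegrable_const)
    hbound (fun x hx => (hA.mul (hζ x hx)).add hR)
  exact ⟨v, hv, hvζ, tendstoUniformlyOn_of_succ hlim.1,
    tendstoUniformlyOn_of_succ (y := fun n => D L 2 (y n)) hlim.2⟩

theorem TendstoC2.tendsto_integral (hL : 0 ≤ L) (hlim : TendstoC2 L y v)
    (hy : ∀ n, MemW41 L (y n)) :
    Tendsto (fun n => ∫ x in (0 : ℝ)..L, y n x) atTop (𝓝 (∫ x in (0 : ℝ)..L, v x)) :=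
  TendstoUniformlyOn.tendsto_intervalIntegral_of_continuousOn
    (.of_forall fun n => by rw [uIcc_of_le hL]; exact (hy n).1.continuousOn)
    (by rw [uIcc_of_le hL]; exact hlim.1)

theorem IsIteration.exists_isSolution_tendstoC2 (hL : 0 < L) (hM : 0 < M)
    (hp : IntervalIntegrable p volume 0 L) (hu : MemW41 L u)
    (hy : IsIteration L a b c M N p u y) {I : ℝ} {ζ : ℝ → ℝ}
    (hK : ∀ n, ∀ x ∈ Icc 0 L, |D L 2 (y n) x| ≤ K)
    (hζ : ∀ x ∈ Icc 0 L, Tendsto (fun n => D L 2 (y n) x) atTop (𝓝 (ζ x)))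
    (hI : Tendsto (fun n => ∫ x in (0 : ℝ)..L, y n x) atTop (𝓝 I)) :
    ∃ v, IsSolution L a b c p v ∧ TendstoC2 L y v := by
  obtain ⟨v, hv, hvζ, hlim⟩ := hy.exists_tendstoC2 hL hM hp hu hK hζ hI
  have hvI : ∫ x in (0 : ℝ)..L, v x = I :=
    tendsto_nhds_unique (hlim.tendsto_integral hL.le (hy.memW41 hu)) hI
  refine ⟨v, ⟨hv.1, hv.2, ?_⟩, hlim⟩
  filter_upwards [hvζ] with x h hx
  have hx' := Ioo_subset_Icc_self hx
  have hvx : D L 2 v x = ζ x := tendsto_nhds_unique (hlim.2.tendsto_at hx') (hζ x hx')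
  have h := h hx
  rw [beamOp] at h
  rw [melanLHS, hvI, hvx]
  rw [hvx] at h
  linear_combination h

end Convergence

section MonotoneIteration

variable {L a b c M N : ℝ} {p u u' v v' w α β : ℝ → ℝ} {y z : ℕ → ℝ → ℝ}

theorem Precedes.refl (L : ℝ) (u : ℝ → ℝ) : Precedes L u u :=
  fun _ _ => ⟨le_rfl, le_rfl⟩

theorem Precedes.trans (huv : Precedes L u v) (hvw : Precedes L v w) : Precedes L u w :=
  fun x hx => ⟨(huv x hx).1.trans (hvw x hx).1, (hvw x hx).2.trans (huv x hx).2⟩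

theorem Precedes.integral_le (hL : 0 ≤ L) (hu : MemW41 L u) (hv : MemW41 L v)
    (huv : Precedes L u v) : ∫ x in (0 : ℝ)..L, u x ≤ ∫ x in (0 : ℝ)..L, v x :=
  intervalIntegral.integral_mono_on hL (hu.1.continuousOn.intervalIntegrable_of_Icc hL)
    (hv.1.continuousOn.intervalIntegrable_of_Icc hL) fun x hx => (huv x hx).1

theorem TendstoC2.const (L : ℝ) (u : ℝ → ℝ) : TendstoC2 L (fun _ => u) u :=
  ⟨fun _ hU => .of_forall fun _ _ _ => refl_mem_uniformity hU,
    fun _ hU => .of_forall fun _ _ _ => refl_mem_uniformity hU⟩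

theorem TendstoC2.precedes (hy : TendstoC2 L y v) (hz : TendstoC2 L z w)
    (h : ∀ n, Precedes L (y n) (z n)) : Precedes L v w := fun x hx =>
  ⟨le_of_tendsto_of_tendsto' (hy.1.tendsto_at hx) (hz.1.tendsto_at hx) fun n => (h n x hx).1,
    le_of_tendsto_of_tendsto' (hz.2.tendsto_at hx) (hy.2.tendsto_at hx) fun n => (h n x hx).2⟩

theorem exists_isStep (hL : 0 < L) (hM : 0 < M) (hN : 0 ≤ N)
    (hp : IntervalIntegrable p volume 0 L) (hu : MemW41 L u) :
    ∃ v, IsStep L a b c M N p u v := by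
  have hu₂ : IntervalIntegrable (D L 2 u) volume 0 L := hu.intervalIntegrable hL (by norm_num)
  obtain ⟨v, hv, hG⟩ := exists_G_eq hL hM hN
    (g := fun x => f a b c p x (∫ t in (0 : ℝ)..L, u t) (D L 2 u x) - M * D L 2 u x +
      N * ∫ t in (0 : ℝ)..L, u t)
    (((((hp.add (hu₂.const_mul a)).add ((hu₂.const_mul b).mul_const _)).sub
      intervalIntegrable_const).sub (hu₂.const_mul M)).add intervalIntegrable_const)
  exact ⟨v, hv.1, hv.2, hG⟩

theorem IsStep.precedes (hL : 0 ≤ L) (hinv : InverseMonotone L M N) (hb : 0 ≤ b)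
    (hw : MemW41 L w) (hwM : a + b * (∫ x in (0 : ℝ)..L, w x) ≤ M)
    (hwN : ∀ x ∈ Icc 0 L, c - b * D L 2 w x ≤ N) (hu : MemW41 L u) (hv : MemW41 L v)
    (huv : Precedes L u v) (hvw : Precedes L v w) (su : IsStep L a b c M N p u u')
    (sv : IsStep L a b c M N p v v') : Precedes L u' v' := by
  refine hinv ⟨su.1, su.2.1⟩ ⟨sv.1, sv.2.1⟩ ?_
  filter_upwards [su.2.2, sv.2.2] with x hGu hGv hx
  rw [hGu hx, hGv hx]
  have hx' := Ioo_subset_Icc_self hx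
  have huv₀ := huv.integral_le hL hu hv
  have hbw := mul_le_mul_of_nonneg_left (hvw.integral_le hL hv hw) hb
  have hbw₂ := mul_le_mul_of_nonneg_left ((huv.trans hvw) x hx').2 hb
  have hslope : 0 ≤ (M - a - b * ∫ t in (0 : ℝ)..L, v t) * (D L 2 u x - D L 2 v x) :=
    mul_nonneg (by linarith) (sub_nonneg.2 (huv x hx').2)
  have hintegral : 0 ≤ (N - c + b * D L 2 u x) *
      ((∫ t in (0 : ℝ)..L, v t) - ∫ t in (0 : ℝ)..L, u t) :=
    mul_nonneg (by linarith [hwN x hx']) (sub_nonneg.2 huv₀)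
  simp only [f]
  linear_combination hslope + hintegral

theorem IsLowerSolution.precedes_step (hinv : InverseMonotone L M N)
    (hu : IsLowerSolution L a b c p u) (su : IsStep L a b c M N p u v) : Precedes L u v := by
  refine hinv ⟨hu.1, hu.2.1⟩ ⟨su.1, su.2.1⟩ ?_
  filter_upwards [su.2.2, hu.2.2] with x hG hlower hx
  have hlower := hlower hx
  rw [hG hx]
  simp only [melanLHS] at hlower
  simp only [f, G]
  linear_combination hlower

theorem IsUpperSolution.step_precedes (hinv : InverseMonotone L M N)
    (hu : IsUpperSolution L a b c p u) (su : IsStep L a b c M N p u v) : Precedes L v u := by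
  refine hinv ⟨su.1, su.2.1⟩ ⟨hu.1, hu.2.1⟩ ?_
  filter_upwards [su.2.2, hu.2.2] with x hG hupper hx
  have hupper := hupper hx
  rw [hG hx]
  simp only [melanLHS] at hupper
  simp only [f, G]
  linear_combination hupper

theorem IsSolution.isIteration_const (hu : IsSolution L a b c p u) (M N : ℝ) :
    IsIteration L a b c M N p u fun _ => u := by
  refine ⟨rfl, fun _ => ⟨hu.1, hu.2.1, ?_⟩⟩
  filter_upwards [hu.2.2] with x h hx
  have h := h hx
  simp only [melanLHS] at h
  simp only [f, G]
  linear_combination h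

theorem IsIteration.tail (hy : IsIteration L a b c M N p u y) :
    IsIteration L a b c M N p (y 1) fun n => y (n + 1) :=
  ⟨rfl, fun n => hy.2 (n + 1)⟩

/-- An interval `[α, β]` of the order `Precedes` that is mapped into itself by the iteration step,
on which the step is everywhere defined and monotone. -/
structure IsBracket (L a b c M N : ℝ) (p α β : ℝ → ℝ) : Prop where
  left : MemW41 L α
  right : MemW41 L β
  left_precedes_right : Precedes L α β
  left_precedes_step : ∀ ⦃v⦄, IsStep L a b c M N p α v → Precedes L α v
  step_precedes_right : ∀ ⦃v⦄, IsStep L a b c M N p β v → Precedes L v β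
  exists_isStep : ∀ ⦃u⦄, MemW41 L u → ∃ v, IsStep L a b c M N p u v
  step_mono : ∀ ⦃u v u' v'⦄, MemW41 L u → MemW41 L v → Precedes L u v → Precedes L v β →
    IsStep L a b c M N p u u' → IsStep L a b c M N p v v' → Precedes L u' v'

theorem isBracket_of_le_sigma (hL : 0 < L) (hb : 0 ≤ b) (hp : IntervalIntegrable p volume 0 L)
    (hM : 0 < M) (hN : 0 ≤ N) (hMN : N ≤ 4 * M / L ^ 3 * σ (√M * L))
    (hα : IsLowerSolution L a b c p α) (hβ : IsUpperSolution L a b c p β) (hαβ : Precedes L α β)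
    (hβM : a + b * (∫ x in (0 : ℝ)..L, β x) ≤ M)
    (hβN : c - b * sInf (D L 2 β '' Icc 0 L) ≤ N) : IsBracket L a b c M N p α β where
  left := hα.1
  right := hβ.1
  left_precedes_right := hαβ
  left_precedes_step _ := hα.precedes_step (inverseMonotone_of_le_sigma hL hM hN hMN)
  step_precedes_right _ := hβ.step_precedes (inverseMonotone_of_le_sigma hL hM hN hMN)
  exists_isStep _ := exists_isStep hL hM hN hp
  step_mono _ _ _ _ := IsStep.precedes hL.le (inverseMonotone_of_le_sigma hL hM hN hMN) hb hβ.1 hβM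
    fun x hx => by
      have hbdd : BddBelow (D L 2 β '' Icc 0 L) :=
        (isCompact_Icc.image_of_continuousOn (hβ.1.continuousOn hL (by norm_num))).bddBelow
      linarith [mul_le_mul_of_nonneg_left (csInf_le hbdd (mem_image_of_mem _ hx)) hb]

namespace IsBracket

theorem exists_isIteration (h : IsBracket L a b c M N p α β) (hu : MemW41 L u) :
    ∃ y, IsIteration L a b c M N p u y := by
  have hstep (s : {w // MemW41 L w}) : ∃ t : {w // MemW41 L w}, IsStep L a b c M N p s.1 t.1 := by
    obtain ⟨v, hv⟩ := h.exists_isStep s.2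
    exact ⟨⟨v, hv.1⟩, hv⟩
  choose T hT using hstep
  refine ⟨fun n => (T^[n] ⟨u, hu⟩).1, rfl, fun n => ?_⟩
  simp only [Function.iterate_succ_apply']
  exact hT _

theorem iteration_precedes_right (h : IsBracket L a b c M N p α β) (hu : MemW41 L u)
    (huβ : Precedes L u β) (hy : IsIteration L a b c M N p u y) (n : ℕ) :
    Precedes L (y n) β := by
  obtain ⟨β', hβ'⟩ := h.exists_isStep h.right
  induction n with
  | zero => rwa [hy.1]
  | succ n ih =>
    exact (h.step_mono (hy.memW41 hu n) h.right ih (.refl L β) (hy.2 n) hβ').trans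
      (h.step_precedes_right hβ')

theorem left_precedes_iteration (h : IsBracket L a b c M N p α β) (hu : MemW41 L u)
    (hαu : Precedes L α u) (huβ : Precedes L u β) (hy : IsIteration L a b c M N p u y) (n : ℕ) :
    Precedes L α (y n) := by
  obtain ⟨α', hα'⟩ := h.exists_isStep h.left
  induction n with
  | zero => rwa [hy.1]
  | succ n ih =>
    exact (h.left_precedes_step hα').trans <| h.step_mono h.left (hy.memW41 hu n) ih
      (h.iteration_precedes_right hu huβ hy n) hα' (hy.2 n)

theorem iteration_mono (h : IsBracket L a b c M N p α β) (hu : MemW41 L u) (hv : MemW41 L v)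
    (huv : Precedes L u v) (hvβ : Precedes L v β) (hy : IsIteration L a b c M N p u y)
    (hz : IsIteration L a b c M N p v z) (n : ℕ) : Precedes L (y n) (z n) := by
  induction n with
  | zero => rwa [hy.1, hz.1]
  | succ n ih =>
    exact h.step_mono (hy.memW41 hu n) (hz.memW41 hv n) ih
      (h.iteration_precedes_right hv hvβ hz n) (hy.2 n) (hz.2 n)

theorem iteration_eqOn (h : IsBracket L a b c M N p α β) (hu : MemW41 L u)
    (huβ : Precedes L u β) (hy : IsIteration L a b c M N p u y)
    (hz : IsIteration L a b c M N p u z) (n : ℕ) : EqOn (y n) (z n) (Icc 0 L) := fun x hx =>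
  le_antisymm (h.iteration_mono hu hu (.refl L u) huβ hy hz n x hx).1
    (h.iteration_mono hu hu (.refl L u) huβ hz hy n x hx).1

theorem lower_iteration_precedes_succ (h : IsBracket L a b c M N p α β)
    (hy : IsIteration L a b c M N p α y) (n : ℕ) : Precedes L (y n) (y (n + 1)) :=
  h.iteration_mono h.left (hy.memW41 h.left 1)
    (h.left_precedes_iteration h.left (.refl L α) h.left_precedes_right hy 1)
    (h.iteration_precedes_right h.left h.left_precedes_right hy 1) hy hy.tail n

theorem upper_iteration_succ_precedes (h : IsBracket L a b c M N p α β)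
    (hy : IsIteration L a b c M N p β y) (n : ℕ) : Precedes L (y (n + 1)) (y n) :=
  h.iteration_mono (hy.memW41 h.right 1) h.right
    (h.iteration_precedes_right h.right (.refl L β) hy 1) (.refl L β) hy.tail hy n

end IsBracket

theorem exists_tendsto_of_mem_Icc_of_monotone_or_antitone {s : ℕ → ℝ} {l r : ℝ}
    (hs : ∀ n, s n ∈ Icc l r) (h : Monotone s ∨ Antitone s) : ∃ t, Tendsto s atTop (𝓝 t) := by
  rcases h with h | h
  · exact ⟨_, tendsto_atTop_ciSup h ⟨r, forall_mem_range.2 fun n => (hs n).2⟩⟩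
  · exact ⟨_, tendsto_atTop_ciInf h ⟨l, forall_mem_range.2 fun n => (hs n).1⟩⟩

theorem IsBracket.exists_bound_abs_D_two (hL : 0 < L) (h : IsBracket L a b c M N p α β) :
    ∃ K, ∀ u, Precedes L α u → Precedes L u β → ∀ x ∈ Icc 0 L, |D L 2 u x| ≤ K := by
  obtain ⟨Kα, hKα⟩ := isCompact_Icc.exists_bound_of_continuousOn
    (h.left.continuousOn hL (k := 2) (by norm_num))
  obtain ⟨Kβ, hKβ⟩ := isCompact_Icc.exists_bound_of_continuousOn
    (h.right.continuousOn hL (k := 2) (by norm_num))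
  refine ⟨max Kβ Kα, fun u hαu huβ x hx => ?_⟩
  exact (abs_le_max_abs_abs (huβ x hx).2 (hαu x hx).2).trans (max_le_max (hKβ x hx) (hKα x hx))

theorem IsBracket.exists_isSolution_tendstoC2 (hL : 0 < L) (hM : 0 < M)
    (hp : IntervalIntegrable p volume 0 L) (h : IsBracket L a b c M N p α β) (hu : MemW41 L u)
    (hαu : Precedes L α u) (huβ : Precedes L u β) (hy : IsIteration L a b c M N p u y)
    (hmono : (∀ n, Precedes L (y n) (y (n + 1))) ∨ ∀ n, Precedes L (y (n + 1)) (y n)) :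
    ∃ v ∈ sector L α β, IsSolution L a b c p v ∧ TendstoC2 L y v := by
  have hmem := hy.memW41 hu
  have hα := h.left_precedes_iteration hu hαu huβ hy
  have hβ := h.iteration_precedes_right hu huβ hy
  have hD (x) (hx : x ∈ Icc 0 L) : ∃ t, Tendsto (fun n => D L 2 (y n) x) atTop (𝓝 t) :=
    exists_tendsto_of_mem_Icc_of_monotone_or_antitone (fun n => ⟨(hβ n x hx).2, (hα n x hx).2⟩) <|
      hmono.symm.imp (fun hanti => monotone_nat_of_le_succ fun n => (hanti n x hx).2)
        fun hinc => antitone_nat_of_succ_le fun n => (hinc n x hx).2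
  choose! ζ hζ using hD
  obtain ⟨I, hI⟩ : ∃ t, Tendsto (fun n => ∫ x in (0 : ℝ)..L, y n x) atTop (𝓝 t) :=
    exists_tendsto_of_mem_Icc_of_monotone_or_antitone
      (fun n => ⟨(hα n).integral_le hL.le h.left (hmem n),
        (hβ n).integral_le hL.le (hmem n) h.right⟩) <|
      hmono.imp
        (fun hinc => monotone_nat_of_le_succ fun n => (hinc n).integral_le hL.le (hmem n) (hmem _))
        fun hanti => antitone_nat_of_succ_le fun n => (hanti n).integral_le hL.le (hmem _) (hmem n)
  obtain ⟨K, hK⟩ := h.exists_bound_abs_D_two hL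
  obtain ⟨v, hv, hlim⟩ := hy.exists_isSolution_tendstoC2 hL hM hp hu
    (fun n => hK (y n) (hα n) (hβ n)) hζ hI
  exact ⟨v, ⟨hv.1.1.of_le (by norm_num), (TendstoC2.const L α).precedes hlim hα,
    hlim.precedes (.const L β) hβ⟩, hv, hlim⟩

end MonotoneIteration

end Melan

theorem theorem4p1_general (L a b c M N : ℝ) (hL : 0 < L) (hb : 0 ≤ b)
    (p : ℝ → ℝ) (hp : IntervalIntegrable p volume 0 L) (hM : 0 < M) (hN : 0 ≤ N)
    (hMN : N ≤ 4 * M / L ^ 3 * Melan.σ (Real.sqrt M * L)) (α β : ℝ → ℝ)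
    (hα : Melan.IsLowerSolution L a b c p α) (hβ : Melan.IsUpperSolution L a b c p β)
    (hαβ : Melan.Precedes L α β) (hβM : a + b * (∫ x in (0 : ℝ)..L, β x) ≤ M)
    (hβN : c - b * sInf (Melan.D L 2 β '' Icc 0 L) ≤ N) :
    (∃ u ∈ Melan.sector L α β, Melan.IsSolution L a b c p u) ∧
    (∀ y₀, y₀ = α ∨ y₀ = β →
      ∃ y, Melan.IsIteration L a b c M N p y₀ y ∧
        ∀ z, Melan.IsIteration L a b c M N p y₀ z → ∀ n, EqOn (z n) (y n) (Icc 0 L)) ∧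
    ∃ ymin ∈ Melan.sector L α β, ∃ ymax ∈ Melan.sector L α β,
      Melan.IsSolution L a b c p ymin ∧ Melan.IsSolution L a b c p ymax ∧
      (∀ u ∈ Melan.sector L α β, Melan.IsSolution L a b c p u →
        Melan.Precedes L ymin u ∧ Melan.Precedes L u ymax) ∧
      ∀ A B : ℕ → ℝ → ℝ,
        Melan.IsIteration L a b c M N p α A → Melan.IsIteration L a b c M N p β B →
        (∀ n, Melan.Precedes L (A n) (A (n + 1)) ∧ Melan.Precedes L (A n) (B n) ∧
          Melan.Precedes L (B (n + 1)) (B n)) ∧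
        TendstoUniformlyOn A ymin atTop (Icc 0 L) ∧
        TendstoUniformlyOn B ymax atTop (Icc 0 L) := by
  have h := Melan.isBracket_of_le_sigma hL hb hp hM hN hMN hα hβ hαβ hβM hβN
  obtain ⟨A, hA⟩ := h.exists_isIteration h.left
  obtain ⟨B, hB⟩ := h.exists_isIteration h.right
  obtain ⟨ymin, hmem_min, hmin, hlim_min⟩ := h.exists_isSolution_tendstoC2 hL hM hp h.left
    (.refl L α) hαβ hA (.inl (h.lower_iteration_precedes_succ hA))
  obtain ⟨ymax, hmem_max, hmax, hlim_max⟩ := h.exists_isSolution_tendstoC2 hL hM hp h.right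
    hαβ (.refl L β) hB (.inr (h.upper_iteration_succ_precedes hB))
  have hA_unique {A'} (hA') := h.iteration_eqOn h.left hαβ (y := A') hA' hA
  have hB_unique {B'} (hB') := h.iteration_eqOn h.right (.refl L β) (y := B') hB' hB
  refine ⟨⟨ymin, hmem_min, hmin⟩, ?_, ymin, hmem_min, ymax, hmem_max, hmin, hmax,
    fun u hu hsol => ⟨?_, ?_⟩, fun A' B' hA' hB' => ⟨fun n => ⟨?_, ?_, ?_⟩, ?_, ?_⟩⟩
  · rintro _ (rfl | rfl)
    exacts [⟨A, hA, fun _ => hA_unique⟩, ⟨B, hB, fun _ => hB_unique⟩]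
  · exact hlim_min.precedes (.const L u)
      (h.iteration_mono h.left hsol.1 hu.2.1 hu.2.2 hA (hsol.isIteration_const M N))
  · exact (Melan.TendstoC2.const L u).precedes hlim_max
      (h.iteration_mono hsol.1 h.right hu.2.2 (.refl L β) (hsol.isIteration_const M N) hB)
  · exact h.lower_iteration_precedes_succ hA' n
  · exact h.iteration_mono h.left h.right hαβ (.refl L β) hA' hB' n
  · exact h.upper_iteration_succ_precedes hB' n
  · exact hlim_min.1.congr (.of_forall fun n => (hA_unique hA' n).symm)
  · exact hlim_max.1.congr (.of_forall fun n => (hB_unique hB' n).symm)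

theorem theorem4p1 (L a b c M N : ℝ) (hL : 0 < L) (ha : 0 < a) (hb : 0 < b) (hc : 0 < c)
    (p : ℝ → ℝ) (hp : IntervalIntegrable p volume 0 L)
    (hM : 0 < M) (hN : 0 < N)
    (hMN : N ≤ 4 * M / L ^ 3 * Melan.σ (Real.sqrt M * L))
    (α β : ℝ → ℝ)
    (hα : Melan.IsLowerSolution L a b c p α)
    (hβ : Melan.IsUpperSolution L a b c p β)
    (hα0 : ∀ x ∈ Icc 0 L, 0 ≤ α x ∧ Melan.D L 2 α x ≤ 0)
    (hαβ : ∀ x ∈ Icc 0 L, α x ≤ β x ∧ Melan.D L 2 β x ≤ Melan.D L 2 α x)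
    (hβM : a + b * (∫ x in (0 : ℝ)..L, β x) ≤ M)
    (hβN : c - b * sInf (Melan.D L 2 β '' Icc 0 L) ≤ N) :
    -- a solution exists in the sector
    (∃ u ∈ Melan.sector L α β, Melan.IsSolution L a b c p u) ∧
    -- the iterations started at `α` and `β` exist and are unique as sequences on `[0, L]`
    (∀ y₀, y₀ = α ∨ y₀ = β →
      ∃ y, Melan.IsIteration L a b c M N p y₀ y ∧
        ∀ z, Melan.IsIteration L a b c M N p y₀ z → ∀ n, EqOn (z n) (y n) (Icc 0 L)) ∧
    -- minimal and maximal solutions `ymin`, `ymax` in the sector; the iterations are monotone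
    -- and converge uniformly to them
    ∃ ymin ∈ Melan.sector L α β, ∃ ymax ∈ Melan.sector L α β,
      Melan.IsSolution L a b c p ymin ∧ Melan.IsSolution L a b c p ymax ∧
      (∀ u ∈ Melan.sector L α β, Melan.IsSolution L a b c p u →
        Melan.Precedes L ymin u ∧ Melan.Precedes L u ymax) ∧
      ∀ A B : ℕ → ℝ → ℝ,
        Melan.IsIteration L a b c M N p α A → Melan.IsIteration L a b c M N p β B →
        (∀ n, Melan.Precedes L (A n) (A (n + 1)) ∧ Melan.Precedes L (A n) (B n) ∧
          Melan.Precedes L (B (n + 1)) (B n)) ∧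
        TendstoUniformlyOn A ymin atTop (Icc 0 L) ∧
        TendstoUniformlyOn B ymax atTop (Icc 0 L) :=
  theorem4p1_general L a b c M N hL hb.le p hp hM hN.le hMN α β hα hβ hαβ hβM hβN
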